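/- Let $G$ be a finite simple bipartite graph with a specified ordered bipartition $(X,Y)$ of its vertex set. For $A\subseteq X$, let the super-neighborhood $\widehat N(A)$ be the set of vertices $y\in Y$ that have at least two neighbors in $A$. Suppose that for every $A\subseteq X$ with $|A|\ge 3$, $$|\widehat N(A)|\ge |A| \quad\text{and}\quad G[A\cup \widehat N(A)]\ \text{is 2-connected.}$$ (A graph is 2-connected if it has at least three vertices, is connected, and remains connected after the deletion of any single vertex.) Then for each $k\in\{3,4,5,6\}$ the graph $G$ is $k$-cyclic; that is, for every $X'\subseteq X$ with $|X'|=k$, $G$ has a cycle $C$ with $V(C)\cap X=X'$. -/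

import Mathlib

namespace Bigraph

variable {V : Type*}

/-- `G` is an `(X, Y)`-bigraph: the sets `X` and `Y` partition the vertex set, and every edge
joins a vertex of `X` to a vertex of `Y`. -/
structure IsXYBigraph (G : SimpleGraph V) (X Y : Set V) : Prop where
  union_eq : X ∪ Y = Set.univ
  bipartite : G.IsBipartiteWith X Y

/-- A graph is 2-connected if it has at least three vertices, is connected, and remains connected
after the deletion of any one vertex. -/
def IsTwoConnected {W : Type*} (H : SimpleGraph W) : Prop :=
  3 ≤ ENat.card W ∧ H.Connected ∧ ∀ w : W, (H.induce {w}ᶜ).Connected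

/-- The super-neighborhood of `A`: the vertices of `Y` with at least two neighbors in `A`. -/
def superNbhd (G : SimpleGraph V) (Y A : Set V) : Set V :=
  {y ∈ Y | 2 ≤ (G.neighborSet y ∩ A).ncard}

/-- For each `A ⊆ X` with `|A| ≥ 3`, the super-neighborhood of `A` has at least `|A|` elements,
and together with `A` it induces a 2-connected subgraph. (Used for finite graphs only.) -/
def SuperNbhdCondition (G : SimpleGraph V) (X Y : Set V) : Prop :=
  ∀ A ⊆ X, 3 ≤ A.ncard →
    A.ncard ≤ (superNbhd G Y A).ncard ∧ IsTwoConnected (G.induce (A ∪ superNbhd G Y A))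

/-- `G` has a cycle `C` based on `X'`, that is, with `V(C) ∩ X = X'`. -/
def HasCycleBasedOn (G : SimpleGraph V) (X X' : Set V) : Prop :=
  ∃ (v : V) (C : G.Walk v v), C.IsCycle ∧ {u | u ∈ C.support} ∩ X = X'

/-- Every `k`-element subset of `X` is the set of `X`-vertices of some cycle. -/
def IsKCyclic (G : SimpleGraph V) (X : Set V) (k : ℕ) : Prop :=
  ∀ X' ⊆ X, X'.ncard = k → HasCycleBasedOn G X X'

end Bigraph

/-!
Only the `k` points of `X'` and the neighborhoods of these points matter. The super-neighborhood
condition has three numerical consequences for them: two points have a common neighbor, a point `a`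
has at least two neighbors that are adjacent to one of two further points `b`, `c` (both come from
the 2-connectedness of the graph spanned by three points), and any set `A` of at least three points
is joined by at least `|A|` vertices (`SuperNbhdCondition.admissible`). A cycle based on `X'` is a
cyclic order of the points together with distinct common neighbors of consecutive points. By Hall's
theorem, a cyclic order admits such representatives unless some set `S` of its consecutive pairs
*covers* less than `|S|` vertices, where a vertex is covered by `S` if it is adjacent to both points
of a pair in `S` (`hasBergeCycle_of_hallKnown`).

So a counterexample provides a violated set `S` for each of the cyclic orders. These violations are
played off against each other. Given upper bounds for the number of vertices covered by some sets of
pairs, one obtains that further sets `S` are not violated: if `S` were violated, some family of sets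
with known lower bounds would cover more vertices, with multiplicity, than permitted by a family of
sets with upper bounds, although every vertex is covered at least as often by the second family as
by the first (`sum_cov_le_of_check`). Here a vertex counts only through its type, the set of points
adjacent to it, and the types that meet `S` in a single pair `e` drop out when `S` without `e` is
known not to be violated (`Knowledge.Valid.isCritical_eq_false`). Facts are carried over to other
sets by the permutations of the points that preserve the upper bounds.

The resulting case distinction is finite. It is recorded as a term of the type `Refutation`, one for
each `k`, and verified by the function `Refutation.check`, which is evaluated by the kernel and
whose soundness is `Refutation.not_isCounterexample`. Its branches end with a cyclic order none of
whose sets of pairs is violated.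
-/

namespace Bigraph

/-! ### Loops over lists that are cheap to evaluate in the kernel -/

section Loops

variable {α β : Type*}

/-- `List.foldr`, defined by the recursor itself so that kernel evaluation is short. -/
def fold (f : α → β → β) (z : β) (l : List α) : β :=
  List.rec z (fun a _ r => f a r) l

/-- `List.all` in terms of `fold`. -/
def allOf (p : α → Bool) (l : List α) : Bool :=
  fold (fun a r => cond (p a) r false) true l

/-- `List.countP` in terms of `fold`. -/
def countOf (p : α → Bool) (l : List α) : ℕ :=
  fold (fun a m => cond (p a) (Nat.succ m) m) 0 l

/-- `List.filter` in terms of `fold`. -/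
def select (p : α → Bool) (l : List α) : List α :=
  fold (fun a r => cond (p a) (a :: r) r) [] l

theorem fold_cons (f : α → β → β) (z : β) (a : α) (l : List α) :
    fold f z (a :: l) = f a (fold f z l) := rfl

theorem fold_eq_foldr (f : α → β → β) (z : β) (l : List α) : fold f z l = l.foldr f z := by
  induction l with
  | nil => rfl
  | cons a l ih => rw [fold_cons, ih, List.foldr_cons]

theorem allOf_iff {p : α → Bool} {l : List α} : allOf p l = true ↔ ∀ a ∈ l, p a = true := by
  induction l with
  | nil => simp [allOf, fold]
  | cons a l ih =>
    rw [allOf, fold_cons, ← allOf]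
    cases h : p a <;> simp [h, ih]

theorem countOf_eq (p : α → Bool) (l : List α) : countOf p l = l.countP p := by
  induction l with
  | nil => rfl
  | cons a l ih =>
    rw [countOf, fold_cons, ← countOf, List.countP_cons, ← ih]
    cases p a <;> rfl

theorem select_eq (p : α → Bool) (l : List α) : select p l = l.filter p := by
  induction l with
  | nil => rfl
  | cons a l ih =>
    rw [select, fold_cons, ← select, List.filter_cons, ih]
    cases p a <;> rfl

end Loops

/-! ### Sets of pairs as bit masks -/

/-- The position of the unordered pair `{i, j}` in the colexicographic enumeration of the pairs of
natural numbers; junk if `i = j`. -/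
def pairCode (i j : ℕ) : ℕ :=
  cond (Nat.blt i j) (Nat.add (Nat.div (Nat.mul j (Nat.pred j)) 2) i)
    (Nat.add (Nat.div (Nat.mul i (Nat.pred i)) 2) j)

/-- The natural number whose binary digits mark the members of `l`. -/
def bitMask (l : List ℕ) : ℕ :=
  l.foldr (fun b m => m ||| 2 ^ b) 0

/-- The mask of a list of pairs. -/
def pairMask (l : List (ℕ × ℕ)) : ℕ :=
  bitMask (l.map fun p => pairCode p.1 p.2)

/-- All pairs `(i, j)` with `i < j < n`. -/
def pairs (n : ℕ) : List (ℕ × ℕ) :=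
  (List.range n).flatMap fun j => (List.range j).map fun i => (i, j)

/-- Whether the digit `k` of `S` is one; the primitive operations keep kernel evaluation short. -/
def bit (S k : ℕ) : Bool :=
  Nat.beq (Nat.land (Nat.shiftRight S k) 1) 1

/-- The entry of `l` at position `k`, or `0` if there is none. -/
def entry (l : List ℕ) : ℕ → ℕ :=
  List.rec (fun _ => 0) (fun a _ r k => Nat.rec a (fun m _ => r m) k) l

/-- The codes of the pairs below `n` that are marked by a mask. -/
def codes (n S : ℕ) : List ℕ :=
  select (bit S) (List.range (n * (n - 1) / 2))

/-- Two masks have a common digit. -/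
def meets (T P : ℕ) : Bool :=
  !Nat.beq (Nat.land T P) 0

/-- The mask of all pairs inside `l`. -/
def cliqueMask (n : ℕ) (l : List ℕ) : ℕ :=
  pairMask ((pairs n).filter fun p => l.contains p.1 && l.contains p.2)

theorem pairCode_eq (i j : ℕ) :
    pairCode i j = if i < j then j * (j - 1) / 2 + i else i * (i - 1) / 2 + j := by
  have h : Nat.blt i j = decide (i < j) := by
    by_cases h : i < j
    · rw [decide_eq_true h, Nat.blt_eq]; exact h
    · rw [decide_eq_false h, ← Bool.not_eq_true, Nat.blt_eq]; exact h
  rw [pairCode, h, Bool.cond_decide]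
  rfl

theorem pairCode_comm (i j : ℕ) : pairCode i j = pairCode j i := by
  rw [pairCode_eq, pairCode_eq]
  split_ifs with h h' h'
  · omega
  · rfl
  · rfl
  · have : i = j := by omega
    rw [this]

theorem pairCode_of_lt {i j : ℕ} (h : i < j) : pairCode i j = j.choose 2 + i := by
  rw [pairCode_eq, if_pos h, Nat.choose_two_right]

theorem pairCode_inj_of_lt {i j k l : ℕ} (h : i < j) (h' : k < l)
    (he : pairCode i j = pairCode k l) : i = k ∧ j = l := by
  rw [pairCode_of_lt h, pairCode_of_lt h'] at he
  have key : ∀ {a b c d : ℕ}, a < b → b < d → b.choose 2 + a < d.choose 2 + c := by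
    intro a b c d hab hbd
    have h1 : (b + 1).choose 2 ≤ d.choose 2 := Nat.choose_le_choose 2 hbd
    have h2 : (b + 1).choose 2 = b + b.choose 2 := by
      rw [Nat.choose_succ_succ' b 1, Nat.choose_one_right]
    omega
  rcases lt_trichotomy j l with hjl | hjl | hjl
  · have := key (c := k) h hjl; omega
  · subst hjl; exact ⟨by omega, rfl⟩
  · have := key (c := i) h' hjl; omega

theorem pairCode_eq_iff {i j k l : ℕ} (h : i ≠ j) (h' : k ≠ l) :
    pairCode i j = pairCode k l ↔ (i = k ∧ j = l) ∨ (i = l ∧ j = k) := by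
  constructor
  · intro he
    rcases lt_or_gt_of_ne h with h1 | h1 <;> rcases lt_or_gt_of_ne h' with h2 | h2
    · exact Or.inl (pairCode_inj_of_lt h1 h2 he)
    · rw [pairCode_comm k l] at he
      exact Or.inr (pairCode_inj_of_lt h1 h2 he)
    · rw [pairCode_comm i j] at he
      exact Or.inr (pairCode_inj_of_lt h1 h2 he).symm
    · rw [pairCode_comm i j, pairCode_comm k l] at he
      exact Or.inl (pairCode_inj_of_lt h1 h2 he).symm
  · rintro (⟨rfl, rfl⟩ | ⟨rfl, rfl⟩)
    · rfl
    · exact pairCode_comm _ _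

theorem mem_pairs {n : ℕ} {p : ℕ × ℕ} : p ∈ pairs n ↔ p.1 < p.2 ∧ p.2 < n := by
  obtain ⟨i, j⟩ := p
  simp only [pairs, List.mem_flatMap, List.mem_range, List.mem_map, Prod.mk.injEq]
  constructor
  · rintro ⟨a, ha, b, hb, rfl, rfl⟩; exact ⟨hb, ha⟩
  · rintro ⟨h1, h2⟩; exact ⟨j, h2, i, h1, rfl, rfl⟩

theorem bit_eq_testBit (S k : ℕ) : bit S k = S.testBit k := by
  have h : Nat.land (Nat.shiftRight S k) 1 = (S.testBit k).toNat := by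
    change (S >>> k) &&& 1 = _
    rw [Nat.and_one_is_mod, Nat.shiftRight_eq_div_pow, Nat.toNat_testBit]
  rw [bit, h]
  cases S.testBit k <;> rfl

theorem entry_eq (l : List ℕ) (k : ℕ) : entry l k = l.getD k 0 := by
  induction l generalizing k with
  | nil => rfl
  | cons a l ih =>
    cases k with
    | zero => rfl
    | succ k => exact ih k

theorem mem_codes {n S k : ℕ} :
    k ∈ codes n S ↔ k < n * (n - 1) / 2 ∧ S.testBit k = true := by
  rw [codes, select_eq, List.mem_filter, List.mem_range, bit_eq_testBit]

theorem nodup_codes (n S : ℕ) : (codes n S).Nodup := by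
  rw [codes, select_eq]
  exact List.nodup_range.filter _

theorem length_codes_le {n S : ℕ} {l : List ℕ} (h : ∀ k ∈ codes n S, k ∈ l) :
    (codes n S).length ≤ l.length :=
  ((nodup_codes n S).subperm h).length_le

theorem le_length_codes {n S : ℕ} {l : List ℕ} (hl : l.Nodup) (h : ∀ k ∈ l, k ∈ codes n S) :
    l.length ≤ (codes n S).length :=
  (hl.subperm h).length_le

theorem pairCode_lt {n i j : ℕ} (h : i ≠ j) (hi : i < n) (hj : j < n) :
    pairCode i j < n * (n - 1) / 2 := by
  rw [← Nat.choose_two_right]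
  wlog hij : i < j generalizing i j
  · rw [pairCode_comm]; exact this h.symm hj hi (by omega)
  rw [pairCode_of_lt hij]
  have h1 : (j + 1).choose 2 ≤ n.choose 2 := Nat.choose_le_choose 2 hj
  have h2 : (j + 1).choose 2 = j + j.choose 2 := by
    rw [Nat.choose_succ_succ' j 1, Nat.choose_one_right]
  omega

theorem testBit_bitMask (l : List ℕ) (k : ℕ) : (bitMask l).testBit k = true ↔ k ∈ l := by
  induction l with
  | nil => simp [bitMask]
  | cons a l ih =>
    have : bitMask (a :: l) = bitMask l ||| 2 ^ a := rfl
    rw [this, Nat.testBit_or, Bool.or_eq_true, ih, Nat.testBit_two_pow, decide_eq_true_eq,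
      List.mem_cons]
    tauto

theorem testBit_pairMask (l : List (ℕ × ℕ)) (k : ℕ) :
    (pairMask l).testBit k = true ↔ ∃ p ∈ l, pairCode p.1 p.2 = k := by
  rw [pairMask, testBit_bitMask, List.mem_map]

theorem meets_iff {T P : ℕ} : meets T P = true ↔ ∃ k, T.testBit k = true ∧ P.testBit k = true := by
  have h1 : meets T P = true ↔ T &&& P ≠ 0 := by
    rw [meets, Bool.not_eq_true', ← Bool.not_eq_true, Nat.beq_eq]
    rfl
  rw [h1]
  constructor
  · intro h
    obtain ⟨k, hk⟩ := Nat.exists_testBit_of_ne_zero h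
    rw [Nat.testBit_and, Bool.and_eq_true] at hk
    exact ⟨k, hk⟩
  · rintro ⟨k, hk⟩ h0
    have : (T &&& P).testBit k = true := by rw [Nat.testBit_and, hk.1, hk.2]; rfl
    rw [h0] at this
    simp at this

/-! ### Set systems and coverage -/

section Systems

variable {n : ℕ} {ι : Type*}

/-- `y` is covered by the mask `P`: it is incident with both members of a pair marked by `P`. Here
`N i` is the set of elements incident with the point `i`. -/
def Covers (N : Fin n → Finset ι) (P : ℕ) (y : ι) : Prop :=
  ∃ i j : Fin n, i ≠ j ∧ P.testBit (pairCode i j) = true ∧ y ∈ N i ∧ y ∈ N j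

/-- A Berge cycle through all points: a cyclic order `σ` of the points and distinct elements
joining consecutive points. -/
def HasBergeCycle (N : Fin n → Finset ι) : Prop :=
  ∃ (σ : Equiv.Perm (Fin n)) (f : Fin n → ι), Function.Injective f ∧
    ∀ i j : Fin n, (j : ℕ) = (i + 1) % n → f i ∈ N (σ i) ∧ f i ∈ N (σ j)

theorem covers_pairMask {N : Fin n → Finset ι} {l : List (ℕ × ℕ)} (hl : ∀ p ∈ l, p.1 ≠ p.2)
    {y : ι} : Covers N (pairMask l) y ↔
      ∃ i j : Fin n, ((i : ℕ), (j : ℕ)) ∈ l ∧ y ∈ N i ∧ y ∈ N j := by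
  constructor
  · rintro ⟨i, j, hij, hb, hi, hj⟩
    obtain ⟨⟨a, b⟩, hp, he⟩ := (testBit_pairMask _ _).1 hb
    rcases (pairCode_eq_iff (hl _ hp) (Fin.val_ne_of_ne hij)).1 he with ⟨h1, h2⟩ | ⟨h1, h2⟩
    · simp only at h1 h2; subst h1; subst h2; exact ⟨i, j, hp, hi, hj⟩
    · simp only at h1 h2; subst h1; subst h2; exact ⟨j, i, hp, hj, hi⟩
  · rintro ⟨i, j, hp, hi, hj⟩
    exact ⟨i, j, fun h => hl _ hp (by rw [h]), (testBit_pairMask _ _).2 ⟨_, hp, rfl⟩, hi, hj⟩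

theorem HasBergeCycle.of_comp {N : Fin n → Finset ι} {σ : Equiv.Perm (Fin n)}
    (h : HasBergeCycle (N ∘ σ)) : HasBergeCycle N := by
  obtain ⟨τ, f, hf, h⟩ := h
  exact ⟨τ.trans σ, f, hf, h⟩

variable [Fintype ι]

open Classical in
/-- The number of elements covered by a set of pairs. -/
noncomputable def cov (N : Fin n → Finset ι) (P : ℕ) : ℕ :=
  (Finset.univ.filter fun y => Covers N P y).card

open Classical in
/-- The consequences of the super-neighborhood condition that the argument uses, in terms of the
neighborhoods `N i` of the points `i`. -/
structure Admissible (N : Fin n → Finset ι) : Prop where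
  pair : ∀ i j, i ≠ j → ∃ y, y ∈ N i ∧ y ∈ N j
  cherry : ∀ i j k, i ≠ j → i ≠ k → j ≠ k →
    2 ≤ (Finset.univ.filter fun y => y ∈ N i ∧ (y ∈ N j ∨ y ∈ N k)).card
  clique : ∀ A : Finset (Fin n), 3 ≤ A.card →
    A.card ≤ (Finset.univ.filter fun y => ∃ i ∈ A, ∃ j ∈ A, i ≠ j ∧ y ∈ N i ∧ y ∈ N j).card

/-- A counterexample subject to the upper bounds `U`, given as pairs of a mask and a bound. -/
structure IsCounterexample (N : Fin n → Finset ι) (U : List (ℕ × ℕ)) : Prop where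
  admissible : Admissible N
  not_hasBergeCycle : ¬HasBergeCycle N
  cov_le : ∀ p ∈ U, cov N p.1 ≤ p.2

theorem cov_mono {N : Fin n → Finset ι} {P Q : ℕ} (h : ∀ y, Covers N P y → Covers N Q y) :
    cov N P ≤ cov N Q := by
  classical
  unfold cov
  refine Finset.card_le_card fun y hy => ?_
  simp only [Finset.mem_filter, Finset.mem_univ, true_and] at hy ⊢
  exact h y hy

theorem cov_congr {N N' : Fin n → Finset ι} {P Q : ℕ} (h : ∀ y, Covers N P y ↔ Covers N' Q y) :
    cov N P = cov N' Q := by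
  unfold cov
  congr 1
  ext y
  simp [h y]

theorem cov_zero (N : Fin n → Finset ι) : cov N 0 = 0 := by
  classical
  unfold cov
  rw [Finset.card_eq_zero, Finset.filter_eq_empty_iff]
  rintro y - ⟨i, j, -, h, -⟩
  simp at h

theorem Admissible.comp {N : Fin n → Finset ι} (h : Admissible N) (σ : Equiv.Perm (Fin n)) :
    Admissible (N ∘ σ) := by
  classical
  refine ⟨fun i j hij => h.pair _ _ (σ.injective.ne hij), fun i j k h1 h2 h3 =>
    h.cherry _ _ _ (σ.injective.ne h1) (σ.injective.ne h2) (σ.injective.ne h3), fun A hA => ?_⟩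
  have := h.clique (A.map σ.toEmbedding) (by simpa using hA)
  rw [Finset.card_map] at this
  refine this.trans (Finset.card_le_card fun y => ?_)
  simp only [Finset.mem_filter, Finset.mem_univ, true_and, Function.comp]
  rintro ⟨i, hi, j, hj, hij, h1, h2⟩
  obtain ⟨a, ha, rfl⟩ := Finset.mem_map.1 hi
  obtain ⟨b, hb, rfl⟩ := Finset.mem_map.1 hj
  exact ⟨a, ha, b, hb, fun e => hij (by rw [e]), h1, h2⟩

end Systems

/-! ### Certificates of non-existence of a counterexample -/

/-- A derivation that no counterexample satisfies the current upper bounds. Sets of pairs are given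
by their masks. -/
inductive Refutation where
  /-- Contradiction by Hall's theorem along the cyclic order `order`. -/
  | cycle (order : List ℕ)
  /-- Case distinction whether the number of elements covered by `S` is less than `|S|`. -/
  | split (S : ℕ) (less rest : Refutation)
  /-- The number of elements covered by `S` is at least `|S|`, by double counting: otherwise the
  sets `lower` would cover more, in total, than allowed by the upper bounds with the indices
  `upper`, where the index `0` refers to `S`. -/
  | bound (S : ℕ) (lower upper : List ℕ) (rest : Refutation)
  /-- From here on, facts are transported along some symmetries of the upper bounds. -/
  | symm (tables : List (List ℕ)) (rest : Refutation)

/-- Several uses of `Refutation.bound` with a single lower and a single upper bound. -/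
def Refutation.forced (l : List (ℕ × ℕ × ℕ)) (rest : Refutation) : Refutation :=
  l.foldr (fun p r => .bound p.1 [p.2.1] [p.2.2] r) rest

/-- What is known during a derivation: the upper bounds `upper`, a number `known` whose binary
digits mark the masks `S` that cover at least `|S|` elements, the possible types `alive` of an
element, that is, masks of all pairs it is incident with, and a list `perms` of symmetries of
`upper`, as tables of maps of pairs. -/
structure Knowledge where
  upper : List (ℕ × ℕ)
  known : ℕ
  alive : List ℕ
  perms : List ℕ

/-- The lists of the numbers below `n` in any order. -/
def permTables : ℕ → List (List ℕ)
  | 0 => [[]]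
  | n + 1 => (permTables n).flatMap fun l => (List.range (n + 1)).map fun i => l.insertIdx i n

/-- The codes of the images of the pairs below `n` under the map `i ↦ t[i]`, as digits in base 256
of a number, in the order of the codes of the pairs. -/
def pairTable (n : ℕ) (t : List ℕ) : ℕ :=
  fold (fun p m => Nat.add (Nat.mul 256 m) (pairCode (entry t p.1) (entry t p.2))) 0 (pairs n)

/-- The image of a set of pairs under a map of pairs given by a table. -/
def push (n t S : ℕ) : ℕ :=
  fold (fun k m => Nat.lor m (Nat.pow 2 (Nat.land (Nat.shiftRight t (Nat.mul 8 k)) 255))) 0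
    (codes n S)

/-- The lower bounds for cliques on at least four points. -/
def cliqueBounds (n : ℕ) : List (ℕ × ℕ) :=
  ((List.range n).sublists.filter fun A => 4 ≤ A.length).map fun A => (cliqueMask n A, A.length)

/-- The sets of pairs `S` known from the outset to cover at least `|S|` elements: single pairs, two
pairs with a common point, and triangles. -/
def initialKnown (n : ℕ) : ℕ :=
  bitMask (((pairs n).map fun p => pairMask [p]) ++
    ((pairs n).flatMap fun p => ((List.range n).filter fun i => i != p.1 && i != p.2).map fun i =>
      pairMask [(i, p.1), (i, p.2)]) ++
    ((pairs n).flatMap fun p => (List.range p.1).map fun i => pairMask [(i, p.1), (i, p.2), p]))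

/-- A lower bound for the number of elements covered by `S`, given the set `D` of known masks. -/
def lowerBound (n D S : ℕ) : ℕ :=
  cond (bit D S) (countOf (bit S) (List.range (n * (n - 1) / 2)))
    (fold (fun p r => cond (Nat.beq p.1 S) p.2 r) 0 (cliqueBounds n))

/-- Some pair `e` belongs to `S` and to `T`, no other pair does, and `S` without `e` is a known
mask. -/
def isCritical (D S T : ℕ) : Bool :=
  cond (Nat.beq (Nat.pow 2 (Nat.log2 (Nat.land T S))) (Nat.land T S))
    (bit D (Nat.xor S (Nat.land T S))) false

/-- Call `f` with the value of `k`, in a way that makes the kernel evaluate `k` first. -/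
def withValue (k : ℕ) (f : ℕ → Bool) : Bool :=
  match k with
  | 0 => f 0
  | m + 1 => f (Nat.succ m)

/-- Call `f` with the list `l` of values, in a way that makes the kernel evaluate them first. -/
def withValues (l : List ℕ) : (List ℕ → Bool) → Bool :=
  List.rec (fun f => f []) (fun a _ r f => withValue a fun b => r fun m => f (b :: m)) l

namespace Knowledge

/-- Assume that `S` covers less than `|S|` elements. If `S` without a pair `e` covers `|S| - 1`
elements, then no element is incident with `e` and with no other pair of `S`. -/
def violate (n : ℕ) (s : Knowledge) (S : ℕ) : Knowledge :=
  { upper := (S, countOf (bit S) (List.range (n * (n - 1) / 2)) - 1) :: s.upper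
    known := s.known
    alive := select (fun T => !isCritical s.known S T) s.alive
    perms := [] }

/-- The updated set of known masks when `S` covers at least `|S|` elements. -/
def learn (n : ℕ) (s : Knowledge) (S : ℕ) : ℕ :=
  fold (fun t D => Nat.lor D (Nat.pow 2 (push n t S))) (Nat.lor s.known (Nat.pow 2 S)) s.perms

/-- The map of pairs given by the table `t` preserves the upper bounds. -/
def preserves (n : ℕ) (s : Knowledge) (t : ℕ) : Bool :=
  allOf (fun p => s.upper.any fun q => Nat.beq q.1 (push n t p.1) && Nat.beq q.2 p.2) s.upper

/-- The knowledge before any case distinction. -/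
def initial (n : ℕ) : Knowledge where
  upper := []
  known := initialKnown n
  alive := (List.range n).sublists.map (cliqueMask n)
  perms := []

end Knowledge

/-- Every nonempty set that arises from the mask `m` by adding some of the pairs with codes in `l`
is known to satisfy Hall's condition. -/
def hallKnown (D : ℕ) : List ℕ → ℕ → Bool
  | [], m => Nat.beq m 0 || bit D m
  | k :: l, m => hallKnown D l m && hallKnown D l (Nat.lor m (Nat.pow 2 k))

/-- The codes of the consecutive pairs of the cyclic order `o`. -/
def consecutive (n : ℕ) (o : List ℕ) : List ℕ :=
  (List.range n).map fun i => pairCode (entry o i) (entry o ((i + 1) % n))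

/-- The checker for refutations. -/
def Refutation.check (n : ℕ) : Refutation → Knowledge → Bool
  | .cycle order, s => order.isPerm (List.range n) && (consecutive n order).Nodup &&
      hallKnown s.known (consecutive n order) 0
  | .split S less rest, s =>
      withValues (s.violate n S).alive
        (fun l => less.check n { s.violate n S with alive := l }) &&
      withValue (s.learn n S) fun D => rest.check n { s with known := D }
  | .bound S lower upper rest, s =>
      let u := upper.map ((s.violate n S).upper.getD · (0, 0))
      let masks := u.map Prod.fst
      Nat.blt (u.map Prod.snd).sum (lower.map (lowerBound n s.known)).sum &&
        allOf (fun T => cond (Nat.ble (countOf (meets T) lower) (countOf (meets T) masks)) true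
          (isCritical s.known S T)) s.alive &&
        withValue (s.learn n S) fun D => rest.check n { s with known := D }
  | .symm tables rest, s =>
      let ts := tables.map (pairTable n)
      (tables.all fun t => t.isPerm (List.range n)) && ts.all (s.preserves n) &&
        withValues s.alive fun l => withValues ts fun ts =>
          rest.check n { s with alive := l, perms := ts }

/-! ### Masks, tables of permutations and coverage -/

theorem withValue_eq (k : ℕ) (f : ℕ → Bool) : withValue k f = f k := by
  cases k <;> rfl

theorem withValues_eq (l : List ℕ) (f : List ℕ → Bool) : withValues l f = f l := by
  induction l generalizing f with
  | nil => rfl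
  | cons a l ih => exact (withValue_eq a fun b => withValues l fun m => f (b :: m)).trans (ih _)

theorem testBit_fold_lor {α : Type*} (g : α → ℕ) (z : ℕ) (l : List α) (k : ℕ) :
    (fold (fun a m => Nat.lor m (Nat.pow 2 (g a))) z l).testBit k = true ↔
      z.testBit k = true ∨ ∃ a ∈ l, g a = k := by
  induction l with
  | nil => simp [fold]
  | cons a l ih =>
    rw [fold_cons]
    change (fold (fun a m => Nat.lor m (Nat.pow 2 (g a))) z l ||| 2 ^ g a).testBit k = true ↔ _
    rw [Nat.testBit_or, Bool.or_eq_true, ih, Nat.testBit_two_pow, decide_eq_true_eq,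
      List.exists_mem_cons_iff]
    exact or_assoc.trans (or_congr_right or_comm)

theorem length_codes_eq (n S : ℕ) :
    countOf (bit S) (List.range (n * (n - 1) / 2)) = (codes n S).length := by
  rw [countOf_eq, codes, select_eq, List.countP_eq_length_filter]

theorem exists_pairCode_eq {n c : ℕ} (h : c < n * (n - 1) / 2) :
    ∃ i j, i < j ∧ j < n ∧ pairCode i j = c := by
  rw [← Nat.choose_two_right] at h
  induction n with
  | zero => simp at h
  | succ n ih =>
    rcases lt_or_ge c (n.choose 2) with hc | hc
    · obtain ⟨i, j, h1, h2, h3⟩ := ih hc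
      exact ⟨i, j, h1, h2.trans n.lt_succ_self, h3⟩
    · have h2 : (n + 1).choose 2 = n + n.choose 2 := by
        rw [Nat.choose_succ_succ' n 1, Nat.choose_one_right]
      have h3 : c - n.choose 2 < n := by omega
      refine ⟨c - n.choose 2, n, h3, n.lt_succ_self, ?_⟩
      rw [pairCode_of_lt h3]
      omega

theorem length_pairs (n : ℕ) : (pairs n).length = n.choose 2 := by
  induction n with
  | zero => rfl
  | succ n ih =>
    have : pairs (n + 1) = pairs n ++ (List.range n).map fun i => (i, n) := by
      simp [pairs, List.range_succ]
    rw [this, List.length_append, ih, List.length_map, List.length_range,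
      Nat.choose_succ_succ' n 1, Nat.choose_one_right, add_comm]

theorem getElem?_pairs {n i j : ℕ} (hij : i < j) (hj : j < n) :
    (pairs n)[pairCode i j]? = some (i, j) := by
  induction n with
  | zero => omega
  | succ n ih =>
    have h : pairs (n + 1) = pairs n ++ (List.range n).map fun i => (i, n) := by
      simp [pairs, List.range_succ]
    rw [h]
    rcases Nat.lt_succ_iff_lt_or_eq.1 hj with h' | rfl
    · have := ih h'
      rw [List.getElem?_append_left]
      · exact this
      · rw [length_pairs, Nat.choose_two_right]
        exact pairCode_lt hij.ne (hij.trans h') h'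
    · rw [pairCode_of_lt hij, List.getElem?_append_right (by rw [length_pairs]; omega),
        length_pairs]
      simp [hij]

/-- The entry of a table of pairs for the pair with code `k`. -/
def digit (t k : ℕ) : ℕ :=
  Nat.land (Nat.shiftRight t (Nat.mul 8 k)) 255

theorem digit_encode {l : List ℕ} (hl : ∀ c ∈ l, c < 256) (k : ℕ) :
    digit (l.foldr (fun c m => 256 * m + c) 0) k = l.getD k 0 := by
  have hmod (a : ℕ) : a &&& 255 = a % 256 := Nat.and_two_pow_sub_one_eq_mod a 8
  induction l generalizing k with
  | nil =>
    change (0 >>> (8 * k)) &&& 255 = 0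
    simp
  | cons c l ih =>
    have hc := hl c List.mem_cons_self
    rw [List.foldr_cons]
    cases k with
    | zero =>
      change ((256 * _ + c) >>> 0) &&& 255 = c
      rw [Nat.shiftRight_zero, hmod]
      omega
    | succ k =>
      refine Eq.trans ?_ (ih (fun x hx => hl x (List.mem_cons_of_mem _ hx)) k)
      change ((256 * l.foldr (fun c m => 256 * m + c) 0 + c) >>> (8 * (k + 1))) &&& 255 =
        (l.foldr (fun c m => 256 * m + c) 0 >>> (8 * k)) &&& 255
      rw [show 8 * (k + 1) = 8 + 8 * k by ring, Nat.shiftRight_add,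
        Nat.shiftRight_eq_div_pow _ 8]
      congr 2
      omega

theorem exists_perm_of_isPerm {n : ℕ} {t : List ℕ} (ht : t.isPerm (List.range n) = true) :
    ∃ σ : Equiv.Perm (Fin n), ∀ i : Fin n, entry t i = σ i := by
  have hp : t.Perm (List.range n) := List.isPerm_iff.1 ht
  have hlen : t.length = n := by simpa using hp.length_eq
  have hnd : t.Nodup := hp.nodup_iff.2 List.nodup_range
  have hlt : ∀ x ∈ t, x < n := fun x hx => List.mem_range.1 (hp.mem_iff.1 hx)
  have hi (i : Fin n) : (i : ℕ) < t.length := by rw [hlen]; exact i.2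
  let f : Fin n → Fin n := fun i => ⟨t[(i : ℕ)]'(hi i), hlt _ (List.getElem_mem _)⟩
  have hf : Function.Injective f := fun i j h => by
    have h' : t[(i : ℕ)]'(hi i) = t[(j : ℕ)]'(hi j) := congrArg Fin.val h
    exact Fin.ext ((hnd.getElem_inj_iff).1 h')
  refine ⟨Equiv.ofBijective f (Finite.injective_iff_bijective.1 hf), fun i => ?_⟩
  rw [entry_eq, List.getD_eq_getElem _ _ (hi i)]
  rfl

theorem digit_pairTable {n : ℕ} (hn : n * (n - 1) / 2 ≤ 256) {t : List ℕ}
    {σ : Equiv.Perm (Fin n)} (hσ : ∀ i : Fin n, entry t i = σ i) {i j : Fin n} (hij : i ≠ j) :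
    digit (pairTable n t) (pairCode i j) = pairCode (σ i) (σ j) := by
  have hcode {i j : Fin n} (hij : i ≠ j) : pairCode (σ i) (σ j) < 256 :=
    (pairCode_lt (Fin.val_ne_of_ne (σ.injective.ne hij)) (σ i).2 (σ j).2).trans_le hn
  have h1 : pairTable n t = ((pairs n).map fun p => pairCode (entry t p.1) (entry t p.2)).foldr
      (fun c m => 256 * m + c) 0 := by
    rw [List.foldr_map, pairTable, fold_eq_foldr]; rfl
  have h2 : ∀ c ∈ (pairs n).map fun p => pairCode (entry t p.1) (entry t p.2), c < 256 := by
    intro c hc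
    obtain ⟨⟨a, b⟩, hp, rfl⟩ := List.mem_map.1 hc
    have hp := mem_pairs.1 hp
    have := hcode (i := ⟨a, hp.1.trans hp.2⟩) (j := ⟨b, hp.2⟩) (by simpa using hp.1.ne)
    rwa [← hσ, ← hσ] at this
  rw [h1, digit_encode h2]
  wlog h : i < j generalizing i j
  · rw [pairCode_comm, pairCode_comm (σ i)]
    exact this hij.symm (lt_of_le_of_ne (not_lt.1 h) hij.symm)
  rw [List.getD_eq_getElem?_getD, List.getElem?_map, getElem?_pairs h j.2]
  simp [hσ]

section Systems

variable {n : ℕ} {ι : Type*}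

theorem covers_push {N : Fin n → Finset ι} {t : ℕ} {σ : Equiv.Perm (Fin n)}
    (hσ : ∀ i j : Fin n, i ≠ j → digit t (pairCode i j) = pairCode (σ i) (σ j)) (S : ℕ) (y : ι) :
    Covers N (push n t S) y ↔ Covers (N ∘ σ) S y := by
  have hbit (k : ℕ) : (push n t S).testBit k = true ↔ ∃ c ∈ codes n S, digit t c = k := by
    rw [push]
    refine (testBit_fold_lor (digit t) 0 (codes n S) k).trans ?_
    simp
  constructor
  · rintro ⟨i, j, hij, hb, hi, hj⟩
    obtain ⟨c, hc, he⟩ := (hbit _).1 hb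
    rw [mem_codes] at hc
    obtain ⟨a, b, hab, hb, rfl⟩ := exists_pairCode_eq hc.1
    have hne : (⟨a, hab.trans hb⟩ : Fin n) ≠ ⟨b, hb⟩ := by simpa using hab.ne
    rw [hσ ⟨a, hab.trans hb⟩ ⟨b, hb⟩ hne] at he
    rcases (pairCode_eq_iff (Fin.val_ne_of_ne (σ.injective.ne hne)) (Fin.val_ne_of_ne hij)).1 he
      with ⟨h1, h2⟩ | ⟨h1, h2⟩
    · rw [← Fin.ext h1] at hi; rw [← Fin.ext h2] at hj
      exact ⟨_, _, hne, hc.2, hi, hj⟩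
    · rw [← Fin.ext h2] at hi; rw [← Fin.ext h1] at hj
      exact ⟨_, _, hne, hc.2, hj, hi⟩
  · rintro ⟨i, j, hij, hb, hi, hj⟩
    refine ⟨σ i, σ j, σ.injective.ne hij, (hbit _).2 ⟨pairCode i j, ?_, hσ i j hij⟩, hi, hj⟩
    exact mem_codes.2 ⟨pairCode_lt (Fin.val_ne_of_ne hij) i.2 j.2, hb⟩

theorem length_codes_push_le (n t S : ℕ) :
    (codes n (push n t S)).length ≤ (codes n S).length := by
  rw [← List.length_map (as := codes n S) (digit t)]
  refine length_codes_le fun k hk => ?_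
  have := (testBit_fold_lor (digit t) 0 (codes n S) k).1 (mem_codes.1 hk).2
  simpa using this

theorem covers_cliqueMask {N : Fin n → Finset ι} {l : List ℕ} {y : ι} :
    Covers N (cliqueMask n l) y ↔
      ∃ i j : Fin n, i ≠ j ∧ (i : ℕ) ∈ l ∧ (j : ℕ) ∈ l ∧ y ∈ N i ∧ y ∈ N j := by
  have hmem (p : ℕ × ℕ) : (p ∈ (pairs n).filter fun p => l.contains p.1 && l.contains p.2) ↔
      (p.1 < p.2 ∧ p.2 < n) ∧ p.1 ∈ l ∧ p.2 ∈ l := by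
    rw [List.mem_filter, mem_pairs]; simp
  rw [cliqueMask, covers_pairMask fun p hp => ((hmem p).1 hp).1.1.ne]
  constructor
  · rintro ⟨i, j, hp, hi, hj⟩
    have := (hmem _).1 hp
    exact ⟨i, j, Fin.ne_of_lt this.1.1, this.2.1, this.2.2, hi, hj⟩
  · rintro ⟨i, j, hij, h1, h2, hi, hj⟩
    rcases lt_or_gt_of_ne hij with h | h
    · exact ⟨i, j, (hmem _).2 ⟨⟨h, j.2⟩, h1, h2⟩, hi, hj⟩
    · exact ⟨j, i, (hmem _).2 ⟨⟨h, i.2⟩, h2, h1⟩, hj, hi⟩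

variable [Fintype ι]

theorem IsCounterexample.comp {N : Fin n → Finset ι} {s : Knowledge} {t : ℕ}
    {σ : Equiv.Perm (Fin n)} (h : IsCounterexample N s.upper)
    (hσ : ∀ i j : Fin n, i ≠ j → digit t (pairCode i j) = pairCode (σ i) (σ j))
    (ht : s.preserves n t = true) : IsCounterexample (N ∘ σ) s.upper := by
  refine ⟨h.admissible.comp σ, fun hc => h.not_hasBergeCycle hc.of_comp, fun p hp => ?_⟩
  rw [Knowledge.preserves, allOf_iff] at ht
  obtain ⟨q, hq, hq'⟩ := List.any_eq_true.1 (ht p hp)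
  rw [Bool.and_eq_true, Nat.beq_eq, Nat.beq_eq] at hq'
  rw [← cov_congr (covers_push hσ p.1), ← hq'.1, ← hq'.2]
  exact h.cov_le q hq

theorem one_le_cov_pair {N : Fin n → Finset ι} (h : Admissible N) {i j : ℕ} (hi : i < n)
    (hj : j < n) (hij : i ≠ j) : 1 ≤ cov N (pairMask [(i, j)]) := by
  classical
  obtain ⟨y, h1, h2⟩ := h.pair ⟨i, hi⟩ ⟨j, hj⟩ (by simpa using hij)
  refine Finset.card_pos.2 ⟨y, ?_⟩
  rw [Finset.mem_filter, covers_pairMask (by simpa using hij)]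
  exact ⟨Finset.mem_univ _, ⟨i, hi⟩, ⟨j, hj⟩, by simp, h1, h2⟩

theorem two_le_cov_cherry {N : Fin n → Finset ι} (h : Admissible N) {i j k : ℕ} (hi : i < n)
    (hj : j < n) (hk : k < n) (hij : i ≠ j) (hik : i ≠ k) (hjk : j ≠ k) :
    2 ≤ cov N (pairMask [(i, j), (i, k)]) := by
  classical
  refine (h.cherry ⟨i, hi⟩ ⟨j, hj⟩ ⟨k, hk⟩ (by simpa using hij) (by simpa using hik)
    (by simpa using hjk)).trans (Finset.card_le_card fun y => ?_)
  rw [Finset.mem_filter, Finset.mem_filter, covers_pairMask (by simp [hij, hik])]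
  rintro ⟨-, h1, h2 | h2⟩
  · exact ⟨Finset.mem_univ _, ⟨i, hi⟩, ⟨j, hj⟩, by simp, h1, h2⟩
  · exact ⟨Finset.mem_univ _, ⟨i, hi⟩, ⟨k, hk⟩, by simp, h1, h2⟩

theorem length_le_cov_clique {N : Fin n → Finset ι} (h : Admissible N) {l : List ℕ}
    (hl : l.Nodup) (hl' : ∀ i ∈ l, i < n) (h3 : 3 ≤ l.length) :
    l.length ≤ cov N (cliqueMask n l) := by
  classical
  let A : Finset (Fin n) := Finset.univ.filter fun i => (i : ℕ) ∈ l
  have hA : A.card = l.length := by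
    rw [← List.toFinset_card_of_nodup hl, ← Finset.card_map Fin.valEmbedding]
    congr 1
    ext i
    simp only [A, Finset.mem_map, Finset.mem_filter, Finset.mem_univ, true_and, List.mem_toFinset,
      Fin.valEmbedding_apply]
    exact ⟨fun ⟨a, ha, e⟩ => e ▸ ha, fun hi => ⟨⟨i, hl' i hi⟩, hi, rfl⟩⟩
  rw [← hA]
  refine (h.clique A (hA ▸ h3)).trans (Finset.card_le_card fun y => ?_)
  rw [Finset.mem_filter, Finset.mem_filter, covers_cliqueMask]
  rintro ⟨-, i, hi, j, hj, hij, h1, h2⟩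
  exact ⟨Finset.mem_univ _, i, j, hij, (Finset.mem_filter.1 hi).2, (Finset.mem_filter.1 hj).2,
    h1, h2⟩

end Systems

/-! ### Soundness of the checker -/

section Soundness

variable {n : ℕ} {ι : Type*} [Fintype ι]

/-- The facts recorded in `s` hold for all counterexamples subject to the upper bounds of `s`. -/
structure Knowledge.Valid (n : ℕ) (ι : Type*) [Fintype ι] (s : Knowledge) : Prop where
  known : ∀ N : Fin n → Finset ι, IsCounterexample N s.upper →
    ∀ S, bit s.known S = true → (codes n S).length ≤ cov N S
  alive : ∀ N : Fin n → Finset ι, IsCounterexample N s.upper →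
    ∀ y, ∃ T ∈ s.alive, ∀ P, meets T P = true ↔ Covers N P y
  perms : ∀ t ∈ s.perms, s.preserves n t = true ∧ ∃ σ : Equiv.Perm (Fin n),
    ∀ i j : Fin n, i ≠ j → digit t (pairCode i j) = pairCode (σ i) (σ j)

theorem IsCounterexample.violate {N : Fin n → Finset ι} {s : Knowledge}
    (h : IsCounterexample N s.upper) {S : ℕ} (hS : cov N S < (codes n S).length) :
    IsCounterexample N (s.violate n S).upper := by
  refine ⟨h.admissible, h.not_hasBergeCycle, fun p hp => ?_⟩
  rcases List.mem_cons.1 hp with rfl | hp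
  · simp only [length_codes_eq]
    omega
  · exact h.cov_le p hp

theorem IsCounterexample.of_violate {N : Fin n → Finset ι} {s : Knowledge} {S : ℕ}
    (h : IsCounterexample N (s.violate n S).upper) :
    IsCounterexample N s.upper ∧ cov N S ≤ (codes n S).length - 1 := by
  refine ⟨⟨h.admissible, h.not_hasBergeCycle, fun p hp => h.cov_le p (List.mem_cons_of_mem _ hp)⟩,
    ?_⟩
  rw [← length_codes_eq]
  exact h.cov_le _ List.mem_cons_self

/-- If `S` without a pair `e` covers at least `|S| - 1` elements and `S` covers no more, then no
element is covered by `S` because of `e` alone. -/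
theorem Knowledge.Valid.isCritical_eq_false {s : Knowledge} (hs : s.Valid n ι)
    {N : Fin n → Finset ι} {S : ℕ} (h : IsCounterexample N (s.violate n S).upper) {y : ι} {T : ℕ}
    (hT : ∀ P, meets T P = true ↔ Covers N P y) : isCritical s.known S T = false := by
  classical
  obtain ⟨h, hS⟩ := h.of_violate
  by_contra hc
  rw [Bool.not_eq_false, isCritical, Bool.cond_false_right, Bool.and_eq_true, Nat.beq_eq] at hc
  obtain ⟨h1, h2⟩ := hc
  set e := Nat.log2 (Nat.land T S)
  replace h1 : T &&& S = 2 ^ e := h1.symm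
  have h3 := hs.known N h _ h2
  replace h3 : (codes n (S ^^^ (T &&& S))).length ≤ cov N (S ^^^ (T &&& S)) := h3
  have h4 : cov N (S ^^^ (T &&& S)) < cov N S := by
    refine Finset.card_lt_card (Finset.ssubset_iff_of_subset ?_ |>.2 ⟨y, ?_, ?_⟩)
    · intro z hz
      rw [Finset.mem_filter] at hz ⊢
      obtain ⟨hz, i, j, hij, hb, hi, hj⟩ := hz
      refine ⟨hz, i, j, hij, ?_, hi, hj⟩
      rw [Nat.testBit_xor, Nat.testBit_and] at hb
      revert hb
      cases S.testBit (pairCode i j) <;> simp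
    · rw [Finset.mem_filter, ← hT, meets_iff]
      have : (T &&& S).testBit e = true := by rw [h1, Nat.testBit_two_pow_self]
      rw [Nat.testBit_and, Bool.and_eq_true] at this
      exact ⟨Finset.mem_univ _, e, this⟩
    · rw [Finset.mem_filter, ← hT, meets_iff]
      rintro ⟨-, k, hk, hk'⟩
      rw [Nat.testBit_xor, Nat.testBit_and, hk] at hk'
      simp at hk'
  have h5 : (codes n S).length ≤ (e :: codes n (S ^^^ (T &&& S))).length := by
    refine length_codes_le fun k hk => ?_
    rw [mem_codes] at hk
    rw [List.mem_cons, mem_codes, Nat.testBit_xor, hk.2, h1, Nat.testBit_two_pow]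
    by_cases hke : e = k
    · exact Or.inl hke.symm
    · exact Or.inr ⟨hk.1, by simp [hke]⟩
  rw [List.length_cons] at h5
  omega

theorem Knowledge.Valid.violate {s : Knowledge} (hs : s.Valid n ι) (S : ℕ) :
    (s.violate n S).Valid n ι where
  known N h := hs.known N h.of_violate.1
  alive N h y := by
    obtain ⟨T, hT, hT'⟩ := hs.alive N h.of_violate.1 y
    refine ⟨T, ?_, hT'⟩
    rw [Knowledge.violate, select_eq, List.mem_filter]
    exact ⟨hT, by rw [hs.isCritical_eq_false h hT']; rfl⟩
  perms t ht := by simp [Knowledge.violate] at ht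

theorem Knowledge.Valid.learn {s : Knowledge} (hs : s.Valid n ι) {S : ℕ}
    (hS : ∀ N : Fin n → Finset ι, IsCounterexample N s.upper → (codes n S).length ≤ cov N S) :
    { s with known := s.learn n S }.Valid n ι := by
  refine ⟨fun N h S' hS' => ?_, hs.alive, hs.perms⟩
  rw [bit_eq_testBit, Knowledge.learn, testBit_fold_lor] at hS'
  rcases hS' with hS' | ⟨t, ht, rfl⟩
  · change (s.known ||| 2 ^ S).testBit S' = true at hS'
    rw [Nat.testBit_or, Bool.or_eq_true, Nat.testBit_two_pow, decide_eq_true_eq,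
      ← bit_eq_testBit] at hS'
    rcases hS' with hS' | rfl
    · exact hs.known N h S' hS'
    · exact hS N h
  · obtain ⟨h1, σ, hσ⟩ := hs.perms t ht
    rw [cov_congr (covers_push hσ S)]
    exact (length_codes_push_le n t S).trans (hS _ (h.comp hσ h1))

theorem lowerBound_le {s : Knowledge} (hs : s.Valid n ι) {N : Fin n → Finset ι}
    (h : IsCounterexample N s.upper) (S : ℕ) : lowerBound n s.known S ≤ cov N S := by
  rw [lowerBound]
  cases hb : bit s.known S with
  | true => rw [cond_true, length_codes_eq]; exact hs.known N h S hb
  | false =>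
    rw [cond_false]
    have hl : ∀ p ∈ cliqueBounds n, p.2 ≤ cov N p.1 := by
      intro p hp
      simp only [cliqueBounds, List.mem_map, List.mem_filter, List.mem_sublists,
        decide_eq_true_eq] at hp
      obtain ⟨A, ⟨hA, h4⟩, rfl⟩ := hp
      exact length_le_cov_clique h.admissible (hA.nodup List.nodup_range)
        (fun i hi => List.mem_range.1 (hA.subset hi)) (by omega)
    generalize cliqueBounds n = l at hl
    induction l with
    | nil => exact Nat.zero_le _
    | cons p l ih =>
      rw [fold_cons]
      cases hp : Nat.beq p.1 S with
      | true =>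
        rw [Nat.beq_eq] at hp
        exact hp ▸ hl p List.mem_cons_self
      | false => exact ih fun q hq => hl q (List.mem_cons_of_mem _ hq)

open Classical in
theorem sum_cov (N : Fin n → Finset ι) (l : List ℕ) :
    (l.map (cov N)).sum = ∑ y : ι, l.countP fun P => decide (Covers N P y) := by
  induction l with
  | nil => simp
  | cons P l ih =>
    simp only [List.map_cons, List.sum_cons, ih, List.countP_cons, Finset.sum_add_distrib,
      decide_eq_true_eq]
    rw [add_comm, cov, Finset.card_filter]

/-- If every element is covered by at least as many members of `l'` as of `l`, then the members of
`l'` cover at least as many elements in total. -/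
theorem sum_cov_le_of_check {N : Fin n → Finset ι} {l l' : List ℕ}
    (h : ∀ y, ∃ T, (∀ P, meets T P = true ↔ Covers N P y) ∧
      countOf (meets T) l ≤ countOf (meets T) l') :
    (l.map (cov N)).sum ≤ (l'.map (cov N)).sum := by
  classical
  rw [sum_cov, sum_cov]
  refine Finset.sum_le_sum fun y _ => ?_
  obtain ⟨T, hT, hle⟩ := h y
  have : (fun P => decide (Covers N P y)) = meets T := by
    ext P; rw [← hT, Bool.decide_eq_true]
  rwa [this, ← countOf_eq, ← countOf_eq]

theorem hallKnown_sublist {D : ℕ} {l : List ℕ} {m : ℕ} (h : hallKnown D l m = true) {a : List ℕ}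
    (ha : a.Sublist l) :
    ∃ S, (∀ k, S.testBit k = true ↔ m.testBit k = true ∨ k ∈ a) ∧ (S = 0 ∨ bit D S = true) := by
  induction ha generalizing m with
  | slnil =>
    rw [hallKnown, Bool.or_eq_true, Nat.beq_eq] at h
    exact ⟨m, by simp, h⟩
  | cons k ha ih =>
    rw [hallKnown, Bool.and_eq_true] at h
    exact ih h.1
  | cons_cons k ha ih =>
    rw [hallKnown, Bool.and_eq_true] at h
    obtain ⟨S, hS, hS'⟩ := ih h.2
    refine ⟨S, fun j => ?_, hS'⟩
    have hor : Nat.lor m (Nat.pow 2 k) = m ||| 2 ^ k := rfl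
    rw [hS, hor, Nat.testBit_or, Bool.or_eq_true, Nat.testBit_two_pow, decide_eq_true_eq,
      List.mem_cons, or_assoc, eq_comm (a := k)]

/-- By Hall's theorem, a cyclic order all of whose sets of consecutive pairs cover sufficiently many
elements yields a Berge cycle. -/
theorem hasBergeCycle_of_hallKnown {s : Knowledge} (hs : s.Valid n ι) {N : Fin n → Finset ι}
    (h : IsCounterexample N s.upper) {o : List ℕ} (ho : o.isPerm (List.range n) = true)
    (hn : 2 ≤ n) (hnd : (consecutive n o).Nodup)
    (hh : hallKnown s.known (consecutive n o) 0 = true) :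
    HasBergeCycle N := by
  classical
  obtain ⟨σ, hσ⟩ := exists_perm_of_isPerm ho
  have hmod (i : Fin n) : ((i : ℕ) + 1) % n < n := Nat.mod_lt _ i.pos
  let next : Fin n → Fin n := fun i => ⟨(i + 1) % n, hmod i⟩
  have hnext (i : Fin n) : σ i ≠ σ (next i) := by
    refine σ.injective.ne fun e => ?_
    have e : (i : ℕ) = (i + 1) % n := congrArg Fin.val e
    rcases Nat.lt_or_ge (i + 1) n with hi | hi
    · rw [Nat.mod_eq_of_lt hi] at e
      omega
    · rw [show (i : ℕ) + 1 = n by omega, Nat.mod_self] at e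
      omega
  let c : Fin n → ℕ := fun i => pairCode (σ i) (σ (next i))
  have hc : consecutive n o = List.ofFn c := by
    rw [consecutive, ← List.map_coe_finRange_eq_range, List.map_map, List.ofFn_eq_map]
    refine List.map_congr_left fun i _ => ?_
    simp only [Function.comp, c]
    rw [hσ i]
    exact congrArg _ (hσ (next i))
  rw [hc] at hnd hh
  have hcinj : Function.Injective c := List.nodup_ofFn.1 hnd
  let F : Fin n → Finset ι := fun i => N (σ i) ∩ N (σ (next i))
  have hall : ∀ A : Finset (Fin n), A.card ≤ (A.biUnion F).card := by
    intro A
    rcases A.eq_empty_or_nonempty with rfl | ⟨i₀, hi₀⟩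
    · simp
    obtain ⟨S, hS, hS'⟩ := hallKnown_sublist hh
      (a := (List.ofFn c).filter fun k => k ∈ A.image c) List.filter_sublist
    have hSA (k : ℕ) : S.testBit k = true ↔ ∃ i ∈ A, c i = k := by
      rw [hS, List.mem_filter, List.mem_ofFn]
      simp only [Nat.zero_testBit, Bool.false_eq_true, false_or, decide_eq_true_eq,
        Finset.mem_image]
      exact ⟨fun h => h.2, fun ⟨i, hi, e⟩ => ⟨⟨i, e⟩, i, hi, e⟩⟩
    have hcard : A.card ≤ (codes n S).length := by
      rw [← Finset.card_image_of_injective A hcinj, ← Finset.length_toList]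
      refine le_length_codes (Finset.nodup_toList _) fun k hk => ?_
      obtain ⟨i, hi, rfl⟩ := Finset.mem_image.1 (Finset.mem_toList.1 hk)
      exact mem_codes.2 ⟨pairCode_lt (Fin.val_ne_of_ne (hnext i)) (σ i).2 (σ (next i)).2,
        (hSA _).2 ⟨i, hi, rfl⟩⟩
    have hS'' : bit s.known S = true := by
      refine hS'.resolve_left fun e => ?_
      have := (hSA (c i₀)).2 ⟨i₀, hi₀, rfl⟩
      simp [e] at this
    refine hcard.trans ((hs.known N h S hS'').trans (Finset.card_le_card fun y hy => ?_))
    obtain ⟨i, j, hij, hb, hi, hj⟩ := (Finset.mem_filter.1 hy).2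
    obtain ⟨a, ha, he⟩ := (hSA _).1 hb
    refine Finset.mem_biUnion.2 ⟨a, ha, Finset.mem_inter.2 ?_⟩
    rcases (pairCode_eq_iff (Fin.val_ne_of_ne (hnext a)) (Fin.val_ne_of_ne hij)).1 he with
      ⟨h1, h2⟩ | ⟨h1, h2⟩
    · rw [Fin.ext h1, Fin.ext h2]; exact ⟨hi, hj⟩
    · rw [Fin.ext h1, Fin.ext h2]; exact ⟨hj, hi⟩
  obtain ⟨f, hf, hfm⟩ := (Finset.all_card_le_biUnion_card_iff_exists_injective F).1 hall
  refine ⟨σ, f, hf, fun i j hj => ?_⟩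
  have := Finset.mem_inter.1 (hfm i)
  rw [show j = next i from Fin.ext hj]
  exact this

/-- Soundness of the checker: a checked refutation rules out all counterexamples subject to the
upper bounds of a valid state of knowledge. -/
theorem Refutation.not_isCounterexample (hn : 2 ≤ n) (hn' : n * (n - 1) / 2 ≤ 256)
    (r : Refutation) {s : Knowledge} (hr : r.check n s = true) (hs : s.Valid n ι)
    (N : Fin n → Finset ι) : ¬IsCounterexample N s.upper := by
  induction r generalizing s N with
  | cycle order =>
    intro h
    simp only [check, Bool.and_eq_true, decide_eq_true_eq] at hr
    exact h.not_hasBergeCycle (hasBergeCycle_of_hallKnown hs h hr.1.1 hn hr.1.2 hr.2)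
  | split S less rest ih₁ ih₂ =>
    simp only [check, Bool.and_eq_true, withValue_eq, withValues_eq] at hr
    refine ih₂ hr.2 (hs.learn fun M hM => ?_) N
    by_contra hlt
    exact ih₁ hr.1 (hs.violate S) M (hM.violate (not_le.1 hlt))
  | bound S lower upper rest ih =>
    simp only [check, Bool.and_eq_true, withValue_eq] at hr
    refine ih hr.2 (hs.learn fun M hM => ?_) N
    by_contra hlt
    have hM' := hM.violate (not_le.1 hlt)
    obtain ⟨⟨h1, h2⟩, -⟩ := hr
    set u := upper.map ((s.violate n S).upper.getD · (0, 0)) with hu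
    rw [Nat.blt_eq] at h1
    rw [allOf_iff] at h2
    have hle : (lower.map (cov M)).sum ≤ ((u.map Prod.fst).map (cov M)).sum := by
      refine sum_cov_le_of_check fun y => ?_
      obtain ⟨T, hT, hT'⟩ := hs.alive M hM y
      refine ⟨T, hT', ?_⟩
      have := h2 T hT
      rw [hs.isCritical_eq_false hM' hT'] at this
      simpa using this
    have hlow : (lower.map (lowerBound n s.known)).sum ≤ (lower.map (cov M)).sum :=
      List.sum_le_sum fun P _ => lowerBound_le hs hM P
    have hup : ((u.map Prod.fst).map (cov M)).sum ≤ (u.map Prod.snd).sum := by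
      rw [List.map_map]
      refine List.sum_le_sum fun p hp => ?_
      obtain ⟨k, -, rfl⟩ := List.mem_map.1 hp
      -- An index out of range stands for the bound `0` on the empty set of pairs.
      cases hk : (s.violate n S).upper[k]? with
      | none => simp [hk, cov_zero]
      | some q => simpa [hk] using hM'.cov_le q (List.mem_of_getElem? hk)
    omega
  | symm tables rest ih =>
    simp only [check, Bool.and_eq_true, withValues_eq, List.all_eq_true] at hr
    refine ih hr.2 ⟨hs.known, hs.alive, fun t ht => ?_⟩ N
    obtain ⟨l, hl, rfl⟩ := List.mem_map.1 ht
    obtain ⟨σ, hσ⟩ := exists_perm_of_isPerm (hr.1.1 l hl)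
    exact ⟨hr.1.2 _ ht, σ, fun i j => digit_pairTable hn' hσ⟩

theorem valid_initial (n : ℕ) : (Knowledge.initial n).Valid n ι where
  known N h S hS := by
    have hN := h.admissible
    have hlen {l : List (ℕ × ℕ)} : (codes n (pairMask l)).length ≤ l.length := by
      rw [← List.length_map (as := l) fun p : ℕ × ℕ => pairCode p.1 p.2]
      refine length_codes_le fun k hk => List.mem_map.2 ?_
      exact (testBit_pairMask l k).1 (mem_codes.1 hk).2
    rw [bit_eq_testBit, Knowledge.initial, initialKnown, testBit_bitMask] at hS
    simp only [List.mem_append, List.mem_map, List.mem_flatMap, mem_pairs, List.mem_filter,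
      List.mem_range, Bool.and_eq_true, bne_iff_ne] at hS
    rcases hS with (⟨p, hp, rfl⟩ | ⟨p, hp, i, ⟨hi, h1, h2⟩, rfl⟩) | ⟨p, hp, i, hi, rfl⟩
    · exact hlen.trans (one_le_cov_pair hN (hp.1.trans hp.2) hp.2 hp.1.ne)
    · exact hlen.trans (two_le_cov_cherry hN hi (hp.1.trans hp.2) hp.2 h1 h2 hp.1.ne)
    · refine hlen.trans (le_trans ?_ ((length_le_cov_clique hN (l := [i, p.1, p.2]) ?_ ?_ ?_).trans
        (cov_mono fun y hy => ?_)))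
      · rfl
      · simp; omega
      · simp; omega
      · simp
      · obtain ⟨a, b, hab, ha, hb, hya, hyb⟩ := covers_cliqueMask.1 hy
        have hne : ∀ q ∈ [(i, p.1), (i, p.2), p], q.1 ≠ q.2 := by
          simp; omega
        rw [covers_pairMask hne]
        have key : ((a : ℕ), (b : ℕ)) ∈ [(i, p.1), (i, p.2), p] ∨
            ((b : ℕ), (a : ℕ)) ∈ [(i, p.1), (i, p.2), p] := by
          have := Fin.val_ne_of_ne hab
          simp only [List.mem_cons, List.not_mem_nil, or_false, Prod.ext_iff] at ha hb ⊢
          omega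
        rcases key with h | h
        exacts [⟨a, b, h, hya, hyb⟩, ⟨b, a, h, hyb, hya⟩]
  alive N _ y := by
    classical
    refine ⟨cliqueMask n ((List.range n).filter fun i => ∃ h : i < n, y ∈ N ⟨i, h⟩),
      List.mem_map.2 ⟨_, List.mem_sublists.2 List.filter_sublist, rfl⟩, fun P => ?_⟩
    rw [meets_iff]
    constructor
    · rintro ⟨k, hk, hP⟩
      obtain ⟨p, hp, rfl⟩ := (testBit_pairMask _ _).1 hk
      simp only [List.mem_filter, List.contains_iff_mem, Bool.and_eq_true, mem_pairs,
        decide_eq_true_eq] at hp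
      obtain ⟨⟨hlt, -⟩, ⟨-, h1, hy1⟩, -, h2, hy2⟩ := hp
      exact ⟨⟨p.1, h1⟩, ⟨p.2, h2⟩, by simpa using hlt.ne, hP, hy1, hy2⟩
    · rintro ⟨i, j, hij, hP, hi, hj⟩
      wlog hlt : i < j generalizing i j
      · exact this j i hij.symm (by rwa [pairCode_comm]) hj hi
          (lt_of_le_of_ne (not_lt.1 hlt) hij.symm)
      refine ⟨_, (testBit_pairMask _ _).2 ⟨(i, j), ?_, rfl⟩, hP⟩
      simp only [List.mem_filter, List.contains_iff_mem, Bool.and_eq_true, mem_pairs,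
        decide_eq_true_eq, List.mem_range]
      exact ⟨⟨hlt, j.2⟩, ⟨i.2, i.2, hi⟩, j.2, j.2, hj⟩
  perms t ht := by simp [Knowledge.initial] at ht

/-- A checked refutation proves that all admissible systems have a Berge cycle. -/
theorem Refutation.hasBergeCycle (hn : 2 ≤ n) (hn' : n * (n - 1) / 2 ≤ 256) (r : Refutation)
    (hr : r.check n (.initial n) = true) {N : Fin n → Finset ι} (hN : Admissible N) :
    HasBergeCycle N := by
  by_contra h
  exact r.not_isCounterexample hn hn' hr (valid_initial n) N ⟨hN, h, by simp [Knowledge.initial]⟩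

end Soundness

/-! ### The refutations for three to six points -/

/-- Three points: the only cyclic order satisfies the condition of Hall's theorem. -/
def refutationThree : Refutation :=
  .symm (permTables 3) <| .cycle [0, 1, 2]

set_option maxRecDepth 100000 in
theorem check_refutationThree : refutationThree.check 3 (.initial 3) = true := by
  decide +kernel

/-- The case distinction for four points. -/
def refutationFour : Refutation :=
  .symm (permTables 4) <| .split 12 (
  .symm [[0, 2, 1, 3], [1, 0, 3, 2], [1, 3, 0, 2], [2, 0, 3, 1], [2, 3, 0, 1], [3, 1, 2, 0],
  [3, 2, 1, 0]] <| .forced [(18, 10, 1), (19, 7, 1), (51, 63, 1)] <| .cycle [0, 1, 3, 2]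
  ) <|
  .split 14 (
  .symm [[2, 3, 0, 1]] <| .forced [(13, 7, 1), (37, 7, 1), (45, 7, 1)] <| .cycle [0, 1, 2, 3]
  ) <|
  .split 30 (
  .symm [[0, 1, 3, 2], [1, 0, 2, 3], [1, 0, 3, 2], [2, 3, 0, 1], [2, 3, 1, 0], [3, 2, 0, 1],
  [3, 2, 1, 0]] <| .forced [(45, 63, 1)] <| .cycle [0, 1, 2, 3]
  ) <|
  .cycle [0, 2, 1, 3]

set_option maxRecDepth 100000 in
theorem check_refutationFour : refutationFour.check 4 (.initial 4) = true := by
  decide +kernel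

set_option maxRecDepth 100000 in
/-- The case distinction for five points. -/
def refutationFive : Refutation :=
  .symm (permTables 5) <| .split 12 (
  .symm [[0, 2, 1, 3, 4], [1, 0, 3, 2, 4], [1, 3, 0, 2, 4], [2, 0, 3, 1, 4], [2, 3, 0, 1, 4],
  [3, 1, 2, 0, 4], [3, 2, 1, 0, 4]] <| .forced [(18, 10, 1), (80, 72, 1), (50, 42, 1), (82, 20, 1),
  (98, 36, 1), (112, 52, 1)] <| .bound 194 [10, 132] [0, 1] <| .forced [(224, 36, 1), (114, 52, 1),
  (226, 36, 1)] <| .split 210 (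
  .symm [[1, 0, 3, 2, 4]] <| .bound 353 [7, 275] [0, 1] <| .forced [(369, 20, 2)] <|
  .cycle [0, 1, 3, 2, 4]
  ) <|
  .forced [(242, 36, 1)] <| .cycle [0, 2, 3, 1, 4]
  ) <|
  .split 44 (
  .symm [[1, 0, 3, 2, 4]] <| .forced [(19, 63, 1)] <| .bound 259 [7, 9] [0, 1] <|
  .forced [(273, 52, 1), (274, 42, 0), (769, 800, 1)] <| .bound 770 [42, 520] [0, 1] <|
  .forced [(275, 25, 1)] <| .bound 786 [42, 52] [0, 1] <| .split 771 (
  .forced [(49, 25, 2), (81, 63, 2), (97, 874, 2), (112, 63, 2), (289, 7, 2), (304, 63, 2),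
  (321, 584, 0), (336, 63, 0), (352, 874, 0), (113, 63, 2), (305, 63, 2), (337, 25, 2),
  (353, 874, 1), (368, 25, 2), (369, 25, 2)] <| .cycle [0, 1, 3, 2, 4]
  ) <|
  .split 787 (
  .symm [[1, 0, 3, 2, 4]] <| .forced [(50, 63, 2), (82, 63, 0), (98, 7, 0), (112, 63, 2),
  (194, 1023, 0), (224, 1023, 2), (114, 25, 2), (210, 1023, 0), (226, 1023, 0), (242, 1023, 1)] <|
  .cycle [0, 2, 3, 1, 4]
  ) <|
  .cycle [0, 1, 3, 4, 2]
  ) <|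
  .split 76 (
  .symm [[0, 1, 2, 4, 3], [0, 2, 1, 3, 4], [0, 2, 1, 4, 3]] <| .forced [(161, 193, 1), (515, 7, 1),
  (545, 13, 1), (163, 42, 1), (547, 7, 1), (673, 13, 1), (675, 7, 1)] <| .cycle [0, 1, 4, 3, 2]
  ) <|
  .split 108 (
  .symm [[2, 4, 0, 3, 1]] <| .forced [(275, 63, 1), (531, 63, 0)] <| .split 785 (
  .symm [[1, 2, 4, 3, 0], [2, 4, 0, 3, 1], [4, 0, 1, 3, 2]] <| .forced [(114, 63, 2),
  (178, 1023, 0), (210, 1023, 1), (226, 1023, 2), (240, 729, 1), (242, 1023, 0)] <|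
  .cycle [0, 2, 3, 1, 4]
  ) <|
  .split 787 (
  .symm [[2, 4, 0, 3, 1]] <| .forced [(114, 63, 2), (178, 1023, 0), (210, 1023, 0), (226, 1023, 2),
  (240, 1023, 0), (242, 1023, 1)] <| .cycle [0, 2, 3, 1, 4]
  ) <|
  .cycle [0, 1, 3, 4, 2]
  ) <|
  .split 236 (
  .symm [[0, 2, 1, 4, 3], [1, 0, 3, 2, 4], [1, 3, 0, 4, 2], [2, 0, 4, 1, 3], [2, 4, 0, 3, 1],
  [3, 1, 4, 0, 2], [3, 4, 1, 2, 0], [4, 2, 3, 0, 1], [4, 3, 2, 1, 0]] <| .forced [(787, 1023, 1)] <|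
  .cycle [0, 1, 3, 4, 2]
  ) <|
  .cycle [0, 3, 2, 1, 4]

set_option maxRecDepth 100000 in
theorem check_refutationFive : refutationFive.check 5 (.initial 5) = true := by
  decide +kernel

set_option maxRecDepth 100000 in
/-- The case distinction for six points. -/
def refutationSix : Refutation :=
  .symm (permTables 6) <| .split 80 (
  .symm [[0, 1, 5, 3, 4, 2], [0, 3, 2, 1, 4, 5], [0, 3, 5, 1, 4, 2], [1, 0, 2, 4, 3, 5],
  [1, 0, 5, 4, 3, 2], [1, 4, 2, 0, 3, 5], [1, 4, 5, 0, 3, 2], [3, 0, 2, 4, 1, 5],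
  [3, 0, 5, 4, 1, 2], [3, 4, 2, 0, 1, 5], [3, 4, 5, 0, 1, 2], [4, 1, 2, 3, 0, 5],
  [4, 1, 5, 3, 0, 2], [4, 3, 2, 1, 0, 5], [4, 3, 5, 1, 0, 2]] <| .forced [(130, 66, 1),
  (2080, 2064, 1), (162, 144, 1)] <| .bound 546 [66, 528] [0, 1] <| .forced [(642, 656, 1),
  (672, 144, 1), (1154, 144, 1)] <| .bound 1184 [1088, 144] [0, 1] <|
  .bound 1568 [1088, 528] [0, 1] <| .forced [(2208, 48, 1), (674, 144, 1), (1666, 656, 1),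
  (1696, 144, 1)] <| .split 1056 (
  .symm [[0, 2, 1, 3, 5, 4], [3, 4, 5, 0, 1, 2], [3, 5, 4, 0, 2, 1]] <| .forced [(513, 65, 2),
  (2050, 66, 2), (259, 1088, 2), (515, 1568, 2), (769, 257, 2), (770, 322, 2)] <|
  .bound 2306 [1026, 2064] [0, 2] <| .forced [(771, 800, 2), (2307, 1088, 2), (2563, 1568, 2),
  (2817, 65, 2), (2818, 546, 2)] <| .bound 8707 [8224, 35] [0, 1] <| .forced [(2819, 1568, 2),
  (8963, 288, 1)] <| .split 2304 (
  .forced [(1028, 52, 3), (1030, 2064, 3), (8198, 10496, 2)] <| .bound 9218 [10498] [1, 2] <|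
  .forced [(9220, 10496, 2), (1158, 2064, 1), (1542, 800, 2), (8326, 384, 1), (8710, 11010, 0),
  (8836, 3712, 0), (9222, 10496, 2), (9346, 10498, 2), (9348, 388, 1), (9730, 2064, 1),
  (9732, 52, 2)] <| .bound 1670 [1568] [2, 3] <| .forced [(8838, 1670, 0), (9350, 2176, 1),
  (9734, 1088, 2), (9858, 2306, 2), (9860, 260, 1)] <| .split 9862 (
  .forced [(4097, 455, 4), (4104, 296, 3), (4608, 1696, 4), (16388, 9218, 3), (517, 2688, 4),
  (521, 10498, 2), (4101, 455, 0), (4105, 193, 4), (4108, 42, 3), (4609, 1670, 4), (4612, 1670, 2),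
  (4616, 656, 4)] <| .bound 16897 [2307] [3, 4] <| .forced [(20481, 24007, 2)] <|
  .bound 20484 [1670] [2, 4] <| .forced [(20488, 656, 2), (20992, 416, 2), (525, 1696, 4),
  (4109, 63, 0), (4613, 11010, 0), (4617, 2817, 4), (4620, 9218, 3), (16901, 2817, 0),
  (16905, 63, 4), (20485, 27280, 2)] <| .bound 20489 [10498] [2, 3] <|
  .bound 20492 [30570] [2, 3] <| .forced [(20993, 11010, 0), (20996, 1158, 2), (21000, 26184, 0),
  (4621, 1670, 0), (16909, 9350, 0), (20493, 32767, 0), (20997, 9734, 0), (21001, 32767, 0),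
  (21004, 31668, 0), (21005, 32767, 1)] <| .cycle [0, 1, 2, 5, 4, 3]
  ) <|
  .cycle [0, 2, 1, 4, 3, 5]
  ) <|
  .bound 11011 [1088, 2304, 8707] [0, 1, 2] <| .cycle [0, 1, 5, 3, 4, 2]
  ) <|
  .split 1058 (
  .forced [(513, 65, 2), (4097, 65, 0), (4104, 42, 0), (4608, 5122, 1), (521, 25, 2), (769, 65, 2),
  (2561, 528, 2), (4105, 25, 0), (4353, 1281, 0), (4360, 42, 0), (4609, 528, 2), (4616, 5122, 1),
  (4864, 1088, 2), (6145, 3073, 0), (6152, 5122, 0), (6656, 3584, 0), (777, 297, 2), (2569, 584, 2),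
  (2817, 528, 2), (4361, 297, 0), (4617, 5122, 1), (4865, 528, 2), (4872, 874, 0)] <|
  .bound 6153 [25, 5122] [0, 1] <| .bound 6408 [42, 5122] [0, 1] <| .forced [(6657, 528, 2),
  (6664, 528, 2)] <| .bound 6912 [1088, 528, 320] [0, 2, 2] <| .forced [(2825, 584, 2),
  (4873, 528, 2), (6665, 528, 2), (6920, 528, 2)] <| .split 6400 (
  .forced [(1030, 48, 3), (8198, 48, 3), (9218, 8224, 3), (9220, 8208, 3), (1158, 3200, 1),
  (1542, 6912, 1), (8326, 14388, 1), (8710, 1030, 1), (8836, 6148, 1), (9222, 9220, 2),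
  (9346, 8352, 3), (9348, 8208, 3), (9730, 322, 1), (9732, 6148, 1), (1670, 48, 3), (8838, 6148, 1),
  (9350, 14388, 1), (9734, 5122, 1), (9858, 5122, 1), (9860, 6148, 1), (9862, 6148, 1)] <|
  .cycle [0, 2, 1, 4, 3, 5]
  ) <|
  .forced [(6401, 35, 1)] <| .split 6409 (
  .bound 1030 [63] [2, 3] <| .forced [(8198, 15423, 1)] <| .bound 9218 [65, 8224] [2, 3] <|
  .forced [(9220, 15423, 1), (1158, 25, 2), (1542, 63, 2), (8326, 63, 0), (8710, 63, 2),
  (8836, 25, 3), (9222, 9218, 2), (9346, 163, 2), (9348, 63, 0), (9730, 25, 2), (9732, 63, 2),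
  (1670, 528, 3), (8838, 1670, 0), (9350, 25, 2), (9734, 63, 2)] <| .bound 9858 [1185] [2, 3] <|
  .forced [(9860, 1670, 0)] <| .split 9862 (
  .forced [(2054, 72, 4)] <| .bound 16390 [32767] [0, 4] <| .bound 18434 [32767] [0, 4] <|
  .forced [(18436, 32767, 2), (2062, 63, 0), (2566, 584, 4), (16398, 32767, 0), (16902, 32767, 0),
  (16906, 32767, 0), (18438, 584, 4), (18442, 32767, 0), (18444, 32767, 0), (18946, 32767, 0)] <|
  .bound 18948 [32767, 65] [0, 3] <| .forced [(2574, 528, 4), (16910, 32767, 0), (18446, 9730, 3),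
  (18950, 32767, 0), (18954, 32767, 0), (18956, 32767, 0), (18958, 32767, 1)] <|
  .cycle [0, 2, 1, 5, 4, 3]
  ) <|
  .cycle [0, 2, 1, 4, 3, 5]
  ) <|
  .forced [(6913, 528, 2), (6921, 528, 2)] <| .cycle [0, 1, 5, 2, 4, 3]
  ) <|
  .split 2082 (
  .forced [(16418, 2064, 2), (24578, 2064, 2), (8227, 10256, 1), (8354, 144, 2), (16419, 35, 1),
  (16515, 16544, 2), (16546, 18560, 2), (24579, 8227, 0), (24609, 65, 2), (24610, 2064, 2),
  (24706, 2208, 1), (24736, 144, 2), (8355, 8226, 1), (16547, 16512, 2), (24611, 35, 1),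
  (24707, 8355, 0), (24737, 193, 2), (24738, 144, 2), (24739, 144, 2)] <| .cycle [0, 1, 4, 5, 3, 2]
  ) <|
  .forced [(1186, 144, 1)] <| .split 1570 (
  .forced [(136, 72, 2), (4097, 65, 0), (4104, 5122, 0), (4224, 192, 0), (137, 25, 2),
  (392, 584, 2), (4105, 25, 0), (4225, 193, 0), (4232, 5122, 0), (4353, 1281, 0), (4360, 874, 0),
  (4480, 656, 0), (8328, 8354, 1), (12289, 9217, 0), (12296, 13354, 1), (12416, 9344, 0),
  (12544, 9728, 0), (393, 25, 2)] <| .bound 4233 [25, 25, 656] [0, 1, 2] <|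
  .forced [(4361, 874, 0)] <| .bound 4481 [656, 65] [0, 2] <| .forced [(4488, 874, 0),
  (8329, 193, 2)] <| .bound 8584 [656, 72] [0, 2] <| .forced [(12297, 13354, 1), (12417, 9345, 0),
  (12424, 9346, 0)] <| .bound 12545 [8481, 9217] [0, 1] <| .forced [(12552, 874, 0),
  (12672, 9856, 0)] <| .bound 4489 [584, 65] [1, 2] <| .forced [(8585, 65, 2)] <|
  .bound 12425 [584, 65] [1, 2] <| .bound 12553 [584, 65] [1, 2] <| .split 12673 (
  .bound 2062 [3076, 12425] [0, 1] <| .forced [(16398, 1023, 0), (16902, 455, 0), (16906, 65, 3),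
  (18438, 24007, 0), (18442, 16906, 0), (18946, 3586, 0)] <|
  .bound 18948 [24007, 65, 528] [0, 2, 3] <| .forced [(2574, 528, 3), (16910, 1023, 0),
  (18446, 32767, 0), (18950, 24007, 1)] <| .bound 18954 [584, 65] [2, 3] <|
  .forced [(18956, 32767, 1), (18958, 32767, 0)] <| .cycle [0, 2, 1, 5, 4, 3]
  ) <|
  .split 12680 (
  .forced [(2089, 12553, 1), (2337, 25, 3), (2344, 874, 0), (16680, 30570, 0), (18465, 25, 3),
  (18472, 13354, 0), (18689, 65, 3), (18720, 30570, 0), (2345, 65, 3), (16681, 65, 3),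
  (18473, 4489, 1), (18697, 25, 3), (18721, 25, 3), (18728, 30570, 1), (18729, 65, 3)] <|
  .cycle [0, 1, 5, 4, 2, 3]
  ) <|
  .bound 12681 [584, 65] [1, 2] <| .cycle [0, 1, 4, 2, 5, 3]
  ) <|
  .split 2210 (
  .forced [(16398, 2062, 1), (16902, 48, 2), (16906, 144, 2), (18438, 48, 2)] <|
  .bound 18442 [18560, 48] [1, 2] <| .forced [(18946, 48, 2), (2574, 2570, 1), (16910, 2574, 0),
  (18446, 2062, 1), (18950, 48, 2)] <| .bound 18954 [42, 144] [1, 2] <| .forced [(18956, 18950, 0),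
  (18958, 2062, 1)] <| .cycle [0, 2, 1, 5, 4, 3]
  ) <|
  .split 2594 (
  .forced [(8205, 2566, 1), (8453, 2820, 0), (24588, 18444, 0), (24836, 2064, 2)] <|
  .bound 8461 [24, 2820] [0, 2] <| .forced [(16653, 24, 2), (24589, 2566, 1), (24837, 8227, 1),
  (24841, 2049, 2)] <| .bound 24844 [2058, 2820] [0, 2] <| .split 24845 (
  .forced [(136, 8834, 2), (4104, 2570, 0), (4224, 455, 3), (4608, 35, 0), (140, 2062, 0),
  (648, 584, 3), (1160, 193, 3), (4108, 8461, 0), (4228, 455, 0), (4232, 2820, 3), (4612, 2337, 0),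
  (4616, 2570, 0), (4736, 7, 3), (5124, 15423, 0), (5128, 11289, 0), (5248, 32767, 0),
  (5632, 11289, 0), (652, 2570, 3), (1164, 1158, 0), (1672, 193, 3), (4236, 1023, 0),
  (4620, 8461, 2), (4740, 455, 0), (4744, 193, 3), (5132, 24837, 0), (5252, 32767, 0),
  (5256, 32767, 0), (5636, 30570, 2), (5640, 11289, 0), (5760, 32767, 2), (1676, 576, 3),
  (4748, 1023, 0), (5260, 32767, 0), (5644, 8461, 0), (5764, 32767, 0), (5768, 32767, 0),
  (5772, 32767, 1)] <| .cycle [0, 3, 4, 1, 2, 5]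
  ) <|
  .cycle [0, 1, 2, 4, 5, 3]
  ) <|
  .split 2720 (
  .symm [[0, 3, 5, 1, 4, 2]] <| .forced [(1409, 1057, 2)] <| .bound 9504 [800, 2064] [1, 2] <|
  .forced [(1441, 1025, 2), (8609, 65, 2), (9377, 193, 2), (9505, 65, 2), (9601, 1441, 0)] <|
  .split 9632 (
  .forced [(8205, 2176, 3), (24836, 24736, 2), (8461, 1441, 0), (16653, 28377, 0)] <|
  .bound 24589 [193, 9224] [0, 3] <| .forced [(24837, 3840, 2), (24841, 417, 2), (24844, 948, 2)] <|
  .split 24845 (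
  .forced [(513, 8461, 2), (4097, 948, 4), (4224, 656, 0), (4608, 656, 0), (515, 35, 0),
  (641, 948, 4), (4099, 455, 0), (4225, 948, 0), (4226, 35, 4), (4609, 193, 4), (4610, 7, 4),
  (4736, 656, 0), (8705, 25, 4), (12289, 3084, 4), (12290, 32767, 0), (12416, 26184, 0),
  (12800, 3080, 4), (643, 656, 4), (4227, 163, 0), (4611, 16419, 0), (4737, 24589, 2),
  (4738, 32767, 2), (8707, 3840, 3), (8833, 3084, 4), (12291, 32767, 0), (12417, 25, 4),
  (12418, 32767, 3), (12801, 3084, 4), (12802, 1158, 4), (12928, 72, 4), (4739, 32767, 1),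
  (8835, 3080, 4), (12419, 32767, 0), (12803, 3080, 4), (12929, 25, 4), (12930, 32767, 3),
  (12931, 3336, 3)] <| .cycle [0, 1, 4, 3, 5, 2]
  ) <|
  .cycle [0, 1, 2, 4, 5, 3]
  ) <|
  .forced [(9633, 65, 2)] <| .cycle [0, 1, 4, 2, 3, 5]
  ) <|
  .split 3106 (
  .symm [[0, 3, 5, 1, 4, 2]] <| .forced [(18720, 2064, 2), (2345, 320, 2), (16681, 2049, 2),
  (18721, 48, 2)] <| .bound 18729 [2089, 16680, 18689] [0, 0, 2] <| .cycle [0, 1, 5, 4, 2, 3]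
  ) <|
  .forced [(1698, 144, 1)] <| .split 2722 (
  .bound 8461 [7, 800, 1023, 2820, 8227] [0, 0, 1, 1, 2] <| .bound 24589 [2574, 16515] [0, 1] <|
  .forced [(24837, 8355, 1), (24844, 2574, 0)] <| .split 24845 (
  .forced [(136, 72, 3), (4104, 1023, 0), (4224, 455, 0), (4608, 455, 0), (140, 25, 3),
  (648, 584, 3), (1160, 193, 3), (4108, 1023, 0), (4228, 455, 0), (4232, 1023, 0), (4612, 455, 0),
  (4616, 1023, 0), (4736, 455, 0)] <| .bound 5124 [32767] [0, 3] <| .forced [(5128, 32767, 0),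
  (5248, 32767, 0), (5632, 32767, 0), (652, 8227, 3), (1164, 1158, 0), (1672, 193, 3),
  (4236, 1023, 0), (4620, 1023, 0), (4740, 455, 0), (4744, 1023, 0), (5132, 32767, 0),
  (5252, 32767, 0), (5256, 32767, 0), (5636, 32767, 0), (5640, 32767, 0), (5760, 32767, 0),
  (1676, 576, 3), (4748, 1023, 2), (5260, 32767, 0), (5644, 32767, 0), (5764, 32767, 2),
  (5768, 32767, 0), (5772, 32767, 1)] <| .cycle [0, 3, 4, 1, 2, 5]
  ) <|
  .cycle [0, 1, 2, 4, 5, 3]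
  ) <|
  .split 3234 (
  .forced [(3844, 576, 2)] <| .split 3340 (
  .forced [(9505, 144, 3)] <| .bound 9632 [42, 388] [2, 3] <| .forced [(9633, 1441, 2)] <|
  .cycle [0, 1, 4, 2, 3, 5]
  ) <|
  .forced [(3852, 3744, 1)] <| .cycle [0, 3, 4, 2, 1, 5]
  ) <|
  .split 3746 (
  .symm [[0, 3, 5, 1, 4, 2]] <| .split 9633 (
  .forced [(513, 65, 3), (4097, 3202, 0), (4104, 8322, 0), (4608, 674, 0), (517, 656, 3),
  (521, 1570, 3), (4101, 9350, 0), (4105, 11289, 0), (4108, 8326, 0), (4609, 1441, 0),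
  (4612, 8838, 0), (4616, 874, 0), (16897, 193, 3), (20481, 24707, 0), (20484, 16390, 0),
  (20488, 24706, 0), (20992, 24738, 0), (525, 8608, 3), (4109, 9350, 0), (4613, 1441, 0),
  (4617, 1441, 0), (4620, 8838, 0), (16901, 2820, 0), (16905, 3202, 3), (20485, 9350, 0),
  (20489, 24707, 0), (20492, 8326, 0), (20993, 1441, 0), (20996, 8838, 0), (21000, 24738, 0),
  (4621, 1023, 0), (16909, 1441, 0), (20493, 32767, 2), (20997, 24738, 0), (21001, 28377, 0),
  (21004, 8838, 0), (21005, 32767, 2)] <| .cycle [0, 1, 2, 5, 4, 3]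
  ) <|
  .cycle [0, 1, 4, 2, 3, 5]
  ) <|
  .cycle [0, 2, 3, 4, 1, 5]
  ) <|
  .split 112 (
  .symm [[0, 2, 1, 3, 4, 5], [4, 1, 2, 3, 0, 5], [4, 2, 1, 3, 0, 5]] <| .forced [(268, 52, 0),
  (524, 52, 1), (772, 52, 0), (776, 800, 1), (1036, 52, 0)] <|
  .bound 1284 [52, 288, 1056] [0, 0, 1] <| .forced [(1540, 52, 0), (1544, 584, 0), (1792, 800, 1),
  (2060, 52, 0), (2568, 584, 1)] <| .bound 2816 [800, 576] [0, 1] <| .forced [(780, 584, 1)] <|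
  .bound 1548 [52, 584] [0, 1] <| .forced [(2572, 584, 1)] <| .split 1288 (
  .forced [(134, 52, 0), (642, 1664, 1), (1030, 42, 0), (1154, 42, 2), (1538, 874, 2),
  (8198, 42, 0), (8322, 42, 2), (8324, 52, 2), (8706, 1538, 0), (8708, 780, 0), (8832, 584, 0),
  (9218, 322, 1), (9220, 52, 2), (9344, 9224, 1), (9728, 584, 0), (646, 584, 1), (1542, 584, 2),
  (1666, 874, 2), (1668, 948, 2), (8326, 9224, 2), (8710, 874, 0), (8834, 42, 2), (8836, 52, 2)] <|
  .bound 9222 [322, 9224, 9224] [0, 1, 2] <| .forced [(9346, 9344, 1), (9348, 52, 2),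
  (9730, 322, 2), (9732, 52, 2)] <| .split 1158 (
  .forced [(4101, 63, 0), (4609, 1023, 3), (16897, 1023, 0), (20481, 63, 3), (20484, 21826, 3),
  (20488, 17472, 3), (20992, 584, 0), (4109, 63, 1), (4613, 1023, 1), (4617, 1023, 3),
  (16397, 63, 1), (16901, 1023, 0), (16905, 63, 3), (20485, 63, 1), (20489, 63, 3),
  (20492, 21826, 3), (20993, 63, 3), (20996, 874, 0), (4621, 1023, 1), (16909, 63, 1),
  (20493, 63, 1), (20997, 1023, 0), (21001, 1023, 0)] <| .split 21000 (
  .forced [(261, 63, 0), (769, 1023, 4), (1029, 455, 0), (1281, 63, 4), (1537, 1023, 4),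
  (8197, 1023, 0), (8449, 1023, 4), (8452, 30570, 4), (8705, 1023, 0), (8960, 26184, 0),
  (9217, 1023, 4), (9472, 26184, 4), (773, 1023, 2), (1285, 63, 2), (1541, 1023, 2),
  (1793, 1023, 4), (1796, 874, 4), (8453, 1023, 2), (8709, 1023, 0), (8961, 63, 4),
  (8964, 30570, 1), (9221, 1023, 2), (9473, 1023, 4), (9476, 30570, 4), (9729, 63, 4),
  (9984, 26184, 1), (1797, 1023, 2), (8965, 63, 2), (9477, 1023, 2), (9733, 63, 2), (9985, 63, 4),
  (9988, 30570, 1), (9989, 63, 2)] <| .cycle [0, 1, 2, 4, 3, 5]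
  ) <|
  .forced [(21004, 42, 3), (21005, 63, 1)] <| .cycle [0, 1, 2, 5, 4, 3]
  ) <|
  .split 9856 (
  .forced [(2054, 52, 0), (2562, 1666, 2), (16898, 1154, 2), (18434, 26184, 2), (18436, 948, 0),
  (18440, 26184, 3), (18944, 18560, 0), (2062, 1158, 0), (2566, 1792, 2), (2570, 874, 3),
  (16398, 26184, 3), (16902, 26184, 1), (16906, 42, 3), (18438, 26184, 2), (18442, 874, 3),
  (18444, 26184, 3), (18946, 1154, 2), (18948, 948, 0), (18952, 26184, 1), (2574, 584, 3),
  (16910, 26184, 1), (18446, 26184, 3), (18950, 26184, 1), (18954, 42, 3), (18956, 26184, 1),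
  (18958, 26184, 1)] <| .cycle [0, 2, 1, 5, 4, 3]
  ) <|
  .forced [(1670, 584, 2), (8838, 1670, 0)] <| .bound 9350 [9224, 192] [1, 2] <| .split 9734 (
  .bound 4101 [63, 322, 4112, 4112] [0, 0, 2, 3] <| .forced [(4609, 63, 2)] <|
  .bound 16897 [63, 322] [2, 3] <| .forced [(20481, 30570, 2), (20484, 1538, 2), (20488, 26184, 3),
  (20992, 20736, 0), (4109, 63, 0), (4613, 800, 3), (4617, 63, 3), (16397, 26184, 3)] <|
  .bound 16901 [63, 800] [0, 2] <| .forced [(16905, 63, 3), (20485, 800, 3), (20489, 30570, 3),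
  (20492, 30570, 3), (20993, 63, 2)] <| .bound 20996 [322, 30570] [0, 2] <|
  .forced [(21000, 30570, 1), (4621, 800, 3)] <| .bound 16909 [63, 26184] [1, 3] <|
  .forced [(20493, 26184, 3), (20997, 30570, 1), (21001, 63, 3), (21004, 42, 3),
  (21005, 30570, 1)] <| .cycle [0, 1, 2, 5, 4, 3]
  ) <|
  .forced [(9858, 1154, 1), (9860, 52, 2)] <| .bound 9862 [192, 1158, 9856] [0, 1, 2] <|
  .cycle [0, 2, 1, 4, 3, 5]
  ) <|
  .split 2308 (
  .forced [(4228, 52, 1), (4232, 6148, 0), (5124, 6148, 0), (5128, 52, 1), (5248, 52, 1),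
  (5632, 52, 1)] <| .bound 1164 [52, 1284] [0, 1] <| .forced [(1668, 1284, 1), (1672, 800, 2),
  (4236, 6148, 1), (4740, 6148, 1), (4744, 584, 2), (5132, 52, 1), (5252, 52, 1), (5256, 1164, 0),
  (5636, 52, 1)] <| .bound 5640 [6148, 780, 2080] [0, 1, 1] <| .forced [(5760, 5636, 0)] <|
  .bound 1676 [584, 948] [0, 2] <| .forced [(4748, 584, 2)] <| .bound 5644 [6148, 780] [0, 1] <|
  .bound 5764 [948, 6148] [0, 1] <| .forced [(5768, 1676, 0)] <| .split 5260 (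
  .forced [(4101, 52, 2), (4609, 5644, 1), (20481, 22916, 2), (20484, 6148, 2), (20488, 22916, 2),
  (20992, 6148, 2), (4109, 6148, 2), (4613, 6148, 2), (4617, 584, 3)] <|
  .bound 16397 [25, 288] [2, 3] <| .forced [(16901, 948, 0), (16905, 25, 3), (20485, 22916, 2),
  (20489, 6148, 2), (20492, 22916, 2), (20993, 6148, 2), (20996, 52, 2), (21000, 1284, 2),
  (4621, 6148, 2)] <| .bound 16909 [25, 288] [2, 3] <| .forced [(20493, 6148, 2), (20997, 6148, 2),
  (21001, 6148, 2), (21004, 6148, 2), (21005, 6148, 2)] <| .cycle [0, 1, 2, 5, 4, 3]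
  ) <|
  .bound 5772 [32, 948] [1, 2] <| .cycle [0, 3, 4, 1, 2, 5]
  ) <|
  .split 2312 (
  .forced [(261, 52, 0), (769, 25, 2), (1029, 1288, 2), (1281, 25, 2), (1537, 521, 2)] <|
  .bound 8197 [25, 10256] [0, 2] <| .forced [(8449, 25, 2), (8452, 52, 1), (8705, 584, 0),
  (8708, 780, 0), (8960, 584, 0)] <| .bound 9217 [9224, 11289] [1, 2] <| .forced [(9220, 52, 2),
  (9472, 9224, 2), (9728, 584, 0), (773, 584, 2), (1285, 1288, 1), (1541, 584, 2), (1793, 25, 2),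
  (1796, 780, 1), (8453, 10256, 1), (8709, 525, 0), (8961, 25, 2), (8964, 52, 1), (9221, 9224, 2),
  (9473, 11289, 2), (9476, 52, 1), (9729, 25, 2), (9732, 52, 2), (9984, 1288, 2), (1797, 584, 2),
  (9477, 9224, 2), (9733, 1288, 2), (9985, 25, 2), (9988, 52, 1)] <| .split 8965 (
  .forced [(134, 63, 0), (138, 63, 3), (8198, 63, 0), (8202, 63, 2), (8204, 525, 3),
  (8322, 1023, 3), (8324, 729, 2), (8328, 584, 3), (16514, 1023, 2), (16516, 729, 2),
  (16520, 27280, 2), (24578, 63, 3), (24580, 25, 3), (24584, 584, 0)] <|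
  .bound 24704 [27280, 144] [0, 2] <| .forced [(142, 63, 0), (8206, 63, 0), (8326, 1023, 0),
  (8330, 1023, 3), (8332, 729, 2), (16398, 63, 0), (16518, 1023, 0), (16522, 1023, 2),
  (16524, 729, 2), (24582, 8961, 0), (24586, 63, 3), (24588, 25, 3), (24706, 1023, 0),
  (24708, 25, 3), (24712, 27280, 0), (8334, 584, 3), (16526, 27280, 2)] <|
  .bound 24590 [63, 584] [1, 3] <| .forced [(24710, 8334, 1), (24714, 63, 2), (24716, 25, 3),
  (24718, 8334, 1)] <| .cycle [0, 2, 1, 4, 5, 3]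
  ) <|
  .forced [(9989, 1288, 1)] <| .cycle [0, 1, 2, 4, 3, 5]
  ) <|
  .split 3076 (
  .forced [(138, 42, 2), (642, 656, 2), (2178, 52, 1), (2184, 52, 0), (2688, 52, 0),
  (4106, 6148, 1), (4226, 52, 1), (4610, 52, 0), (6146, 5122, 1), (6152, 52, 1), (6272, 6148, 1),
  (6656, 52, 1), (650, 42, 2)] <| .bound 2186 [1156, 2054] [0, 1] <| .forced [(2570, 584, 2)] <|
  .bound 2690 [1156, 2054] [0, 1] <| .forced [(2696, 584, 2), (4234, 6148, 1), (4618, 584, 2),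
  (4738, 6148, 1), (4744, 584, 2), (6154, 6148, 1), (6274, 52, 1), (6280, 6148, 1), (6658, 6148, 1),
  (6664, 584, 2), (6784, 6148, 1), (2698, 584, 2), (4746, 584, 2), (6282, 6148, 1), (6666, 6148, 1),
  (6786, 6148, 1), (6792, 6148, 1), (6794, 6148, 1)] <| .cycle [0, 2, 5, 1, 4, 3]
  ) <|
  .split 3080 (
  .forced [(259, 322, 0), (515, 584, 1), (769, 800, 2), (770, 322, 2)] <|
  .bound 2051 [3073, 2112] [0, 1] <| .forced [(2305, 3073, 1), (2306, 322, 1), (2561, 584, 1),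
  (8195, 3073, 0), (8449, 11289, 2), (8450, 322, 2)] <| .bound 8705 [3073, 11289] [0, 2] <|
  .forced [(8706, 584, 0), (8960, 584, 0), (10241, 3073, 1), (10242, 9224, 1), (10496, 9224, 2),
  (10752, 584, 0), (771, 800, 2), (2307, 1288, 1), (2563, 584, 1), (2817, 3073, 1), (2818, 800, 2),
  (8451, 9224, 1), (8707, 2563, 0), (8961, 25, 2), (8962, 2058, 1), (10243, 9224, 1),
  (10497, 8449, 1), (10498, 322, 1), (10753, 3073, 1), (10754, 2058, 1), (11008, 1288, 2),
  (2819, 800, 2), (8963, 2819, 0), (10499, 9224, 1), (11009, 3073, 1), (11010, 2058, 1)] <|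
  .split 10755 (
  .forced [(18434, 26184, 2), (18440, 26184, 3), (18944, 26184, 0), (2062, 63, 0), (2566, 63, 0),
  (2570, 2563, 2), (16398, 26184, 2), (16902, 526, 0), (16906, 3073, 2), (18438, 26184, 2),
  (18442, 26184, 2), (18444, 63, 2), (18946, 26184, 0), (18948, 63, 2), (18952, 26184, 0),
  (2574, 584, 3), (16910, 2574, 1), (18446, 26184, 2), (18950, 18446, 1), (18954, 3073, 2),
  (18956, 63, 2), (18958, 18446, 1)] <| .cycle [0, 2, 1, 5, 4, 3]
  ) <|
  .bound 11011 [72, 1288] [1, 2] <| .cycle [0, 1, 5, 3, 4, 2]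
  ) <|
  .split 3328 (
  .symm [[2, 1, 0, 5, 4, 3]] <| .forced [(20481, 3073, 1), (20488, 17472, 1)] <|
  .bound 4109 [25, 320, 1284, 1288] [0, 0, 1, 2] <| .bound 4613 [1284, 1792] [0, 1] <|
  .forced [(4617, 584, 2)] <| .bound 16901 [17472, 1284] [0, 1] <| .forced [(16905, 25, 2),
  (20485, 17472, 1), (20489, 20736, 1)] <| .bound 20993 [3073, 20736] [0, 1] <|
  .bound 21000 [20736, 1288] [0, 1] <| .forced [(4621, 584, 2)] <|
  .bound 16909 [25, 584, 584, 320, 1284, 1288] [0, 0, 1, 2, 2, 2] <|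
  .bound 21001 [25, 25, 584, 288, 320] [0, 1, 2, 2, 2] <| .split 21005 (
  .forced [(134, 63, 0), (642, 1023, 3), (1030, 5122, 0), (1154, 63, 2), (1538, 4621, 2)] <|
  .bound 8198 [15423, 288] [0, 3] <| .forced [(8322, 32767, 3), (8324, 28377, 2)] <|
  .bound 8706 [25, 15423] [0, 2] <| .forced [(8708, 4621, 0), (8832, 25088, 0), (9218, 8198, 2)] <|
  .bound 9220 [8224, 4621] [2, 3] <| .forced [(9344, 26184, 3)] <|
  .bound 9728 [26184, 1088, 1088] [0, 2, 3] <| .forced [(646, 1023, 0), (1158, 63, 0),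
  (1542, 4621, 0), (1666, 1023, 0), (1668, 4621, 0), (8326, 32767, 0), (8710, 15423, 0),
  (8834, 32767, 0), (8836, 28377, 0), (9222, 20736, 2), (9346, 32767, 2), (9348, 28377, 2),
  (9730, 63, 2), (9732, 4109, 2), (9856, 1160, 3), (1670, 584, 3), (8838, 32767, 0),
  (9350, 9856, 2), (9734, 15423, 0), (9858, 32767, 0), (9860, 6148, 2), (9862, 32767, 1)] <|
  .cycle [0, 2, 1, 4, 3, 5]
  ) <|
  .cycle [0, 1, 2, 5, 4, 3]
  ) <|
  .split 3584 (
  .forced [(41, 25, 2), (137, 729, 2), (161, 193, 2), (168, 584, 2), (4129, 3073, 0),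
  (4136, 584, 2), (4225, 193, 1), (4256, 656, 2), (16417, 3073, 2), (16424, 17472, 1),
  (16513, 19649, 2), (16520, 17472, 1), (16544, 17472, 1), (20488, 584, 2), (20512, 20992, 0),
  (20608, 656, 2), (169, 729, 2), (4137, 584, 2), (4233, 648, 2), (4257, 656, 2), (4264, 584, 2),
  (16425, 25, 2), (16521, 729, 2), (16545, 19649, 2), (16552, 584, 2), (20489, 584, 2)] <|
  .bound 20513 [3073, 17472] [0, 1] <| .forced [(20520, 584, 2), (20609, 193, 1), (20616, 584, 2),
  (20640, 656, 2), (4265, 1664, 1), (16553, 729, 2), (20521, 584, 2), (20617, 648, 2),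
  (20641, 656, 2), (20648, 584, 2), (20649, 648, 2)] <| .cycle [0, 1, 4, 5, 2, 3]
  ) <|
  .split 1292 (
  .forced [(131, 455, 0), (515, 63, 1), (641, 948, 2), (642, 948, 2), (4099, 63, 1),
  (4225, 4101, 0), (4226, 52, 0), (4610, 874, 1), (8195, 9224, 0), (8321, 25, 2), (8322, 42, 2),
  (8705, 584, 0), (8706, 522, 0)] <| .bound 8832 [584, 192] [0, 2] <|
  .bound 12289 [9224, 8208] [0, 2] <| .forced [(12290, 5122, 0), (12416, 9224, 2), (12800, 5128, 2),
  (643, 1023, 1), (4227, 63, 1), (4611, 63, 1), (4737, 4620, 1), (4738, 874, 1), (8323, 63, 1),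
  (8707, 63, 1), (8833, 25, 2), (8834, 42, 2), (12291, 63, 1), (12418, 13354, 1)] <|
  .bound 12801 [25, 525] [0, 1] <| .forced [(12802, 13354, 0)] <| .bound 12928 [948, 1088] [0, 2] <|
  .forced [(4739, 1023, 1), (8835, 63, 1), (12803, 63, 1)] <| .split 12417 (
  .forced [(2062, 15423, 2), (2566, 1023, 2), (2570, 1023, 2), (16398, 63, 2), (16902, 1023, 2),
  (16906, 1023, 3), (18438, 15423, 2), (18442, 15423, 2), (18444, 11289, 2), (18946, 32767, 2),
  (18948, 28377, 2), (18952, 28377, 2), (2574, 1023, 2), (16910, 1023, 2), (18446, 15423, 2),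
  (18950, 32767, 2), (18954, 32767, 2), (18956, 28377, 2), (18958, 32767, 2)] <|
  .cycle [0, 2, 1, 5, 4, 3]
  ) <|
  .forced [(12419, 63, 1)] <| .split 12929 (
  .forced [(2062, 1023, 1), (2566, 1023, 2), (2570, 1023, 2), (16398, 1023, 2), (16902, 1023, 0),
  (16906, 63, 3), (18438, 32767, 2), (18442, 32767, 2), (18444, 28377, 2), (18946, 32767, 0),
  (18948, 28377, 0), (18952, 28377, 0), (2574, 1023, 2), (16910, 63, 2), (18446, 32767, 2),
  (18950, 32767, 1), (18954, 32767, 1), (18956, 28377, 1), (18958, 32767, 1)] <|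
  .cycle [0, 2, 1, 5, 4, 3]
  ) <|
  .split 12930 (
  .forced [(4109, 63, 2), (4613, 1023, 2), (4617, 1023, 2), (16397, 1023, 2), (16901, 1023, 0),
  (16905, 63, 3), (20485, 1023, 2), (20489, 1023, 2), (20492, 30570, 2), (20993, 1023, 0),
  (20996, 30570, 0), (21000, 30570, 0), (4621, 1023, 2), (16909, 63, 2), (20493, 1023, 2),
  (20997, 63, 2), (21001, 63, 2), (21004, 30570, 1), (21005, 63, 2)] <| .cycle [0, 1, 2, 5, 4, 3]
  ) <|
  .forced [(12931, 63, 1)] <| .cycle [0, 1, 4, 3, 5, 2]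
  ) <|
  .split 1796 (
  .forced [(41, 25, 2), (137, 729, 2), (161, 948, 2), (168, 584, 2), (4129, 4609, 0),
  (4136, 584, 2), (4225, 1156, 0), (4256, 948, 0), (16417, 17472, 2), (16424, 584, 2),
  (16513, 1156, 0), (16520, 656, 0), (16544, 656, 0), (20512, 17472, 0), (20608, 20484, 0),
  (169, 729, 2), (4137, 584, 2), (4233, 584, 2), (4257, 948, 1), (4264, 584, 2), (16425, 25, 2),
  (16521, 25, 2), (16545, 948, 0), (16552, 584, 2), (20489, 584, 2), (20513, 16901, 1),
  (20520, 584, 2)] <| .bound 20609 [948, 4101] [0, 1] <| .forced [(20616, 584, 2), (20640, 948, 0),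
  (4265, 584, 2), (16553, 25, 2), (20521, 584, 2), (20617, 584, 2), (20648, 584, 2)] <|
  .split 20641 (
  .forced [(2062, 1023, 2), (2566, 24007, 2), (2570, 1023, 2), (16398, 1023, 2), (16906, 1023, 3),
  (18438, 24007, 0), (18442, 526, 2), (18444, 4265, 0), (18946, 24007, 0), (18948, 948, 0),
  (18952, 4265, 0), (2574, 1023, 2), (16910, 1023, 2), (18446, 63, 2), (18950, 24007, 1),
  (18954, 63, 2), (18956, 584, 3), (18958, 584, 3)] <| .cycle [0, 2, 1, 5, 4, 3]
  ) <|
  .forced [(20649, 584, 2)] <| .cycle [0, 1, 4, 5, 2, 3]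
  ) <|
  .forced [(1800, 800, 1)] <| .split 2316 (
  .forced [(37, 25, 0), (545, 25, 2), (548, 780, 2), (1029, 3073, 0), (1057, 25, 0),
  (1060, 1292, 0), (1537, 1796, 1), (1568, 584, 2), (16417, 25, 2), (16420, 52, 0), (16928, 584, 0),
  (17409, 1292, 1), (17412, 3076, 0), (17440, 17472, 2), (17920, 1292, 1), (549, 584, 2),
  (1061, 1292, 1), (1541, 584, 2), (1569, 584, 2), (1572, 800, 2), (16421, 16397, 1),
  (16929, 25, 2), (16932, 780, 0), (17413, 1061, 1), (17441, 1061, 1), (17444, 1292, 1),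
  (17921, 16905, 0), (17924, 17444, 0), (17952, 1292, 1), (1573, 584, 2), (17445, 1061, 1),
  (17925, 1061, 1), (17953, 1061, 1), (17956, 1292, 1)] <| .split 16933 (
  .forced [(22, 63, 0), (530, 25, 3), (532, 525, 3), (1030, 63, 0), (1042, 42, 0),
  (1044, 3073, 0)] <| .bound 1538 [584, 1569] [0, 3] <| .forced [(1552, 1569, 3), (16402, 63, 3),
  (16404, 545, 3), (16912, 584, 0)] <| .bound 17410 [72, 1573] [0, 3] <| .forced [(17424, 1573, 3),
  (534, 584, 3), (1046, 63, 0), (1542, 1573, 0), (1554, 584, 3), (1556, 1573, 2), (16406, 63, 2),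
  (16914, 63, 3), (16916, 25, 3), (17414, 1573, 0), (17426, 1573, 0), (17428, 1573, 2),
  (17922, 17921, 0), (17936, 1061, 3), (1558, 584, 3), (16918, 63, 2), (17430, 584, 3),
  (17926, 1558, 0), (17938, 1558, 0), (17940, 1061, 2)] <| .split 17942 (
  .forced [(131, 1558, 2), (515, 1558, 3), (641, 729, 4), (642, 1023, 4), (4099, 3080, 0),
  (4225, 63, 3), (4226, 63, 0), (4610, 1558, 0), (8195, 1558, 3), (8321, 729, 4), (8322, 1023, 4),
  (8705, 25, 4), (8706, 1554, 0), (8832, 25088, 0), (12289, 15423, 3)] <|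
  .bound 12290 [15423, 72] [0, 4] <| .forced [(12416, 32767, 3), (12800, 1046, 4), (643, 1023, 3),
  (4227, 63, 0), (4611, 1558, 0), (4737, 1023, 3), (4738, 1023, 0), (8323, 1023, 3),
  (8707, 17430, 2), (8833, 25, 4), (8834, 63, 4), (12291, 16901, 3), (12417, 32767, 3),
  (12418, 32767, 0), (12801, 15423, 0), (12802, 15423, 0), (12928, 32767, 2), (4739, 584, 4),
  (8835, 63, 3), (12419, 32767, 0), (12803, 15423, 0), (12929, 32767, 2), (12930, 32767, 0),
  (12931, 32767, 1)] <| .cycle [0, 1, 4, 3, 5, 2]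
  ) <|
  .cycle [0, 2, 1, 3, 4, 5]
  ) <|
  .forced [(17957, 1061, 1)] <| .cycle [0, 1, 2, 3, 4, 5]
  ) <|
  .split 2820 (
  .forced [(41, 25, 2), (137, 729, 2), (161, 193, 2), (168, 584, 2), (4129, 4613, 1),
  (4136, 584, 2), (4225, 6148, 0), (4256, 948, 0), (16417, 16897, 2), (16424, 584, 2),
  (16513, 948, 1), (16520, 780, 1), (16544, 948, 1), (20512, 18944, 0), (20608, 6148, 0),
  (169, 729, 2), (4137, 525, 1), (4233, 584, 2), (4257, 948, 1), (4264, 948, 1), (16425, 16905, 2),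
  (16521, 25, 2), (16545, 948, 1), (16552, 584, 2), (20489, 584, 2), (20513, 4613, 1),
  (20520, 584, 2), (20609, 948, 1), (20616, 584, 2), (20640, 948, 1), (4265, 584, 2),
  (16553, 729, 1), (20521, 525, 1), (20617, 4265, 1), (20641, 948, 1), (20648, 584, 2),
  (20649, 4265, 1)] <| .cycle [0, 1, 4, 5, 2, 3]
  ) <|
  .forced [(2824, 584, 1)] <| .split 3084 (
  .forced [(138, 42, 2)] <| .bound 642 [52, 1672] [1, 2] <| .forced [(2178, 52, 0), (2184, 1164, 0),
  (2688, 652, 1), (4106, 42, 0), (4226, 4236, 1)] <| .bound 4610 [526, 2566] [0, 1] <|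
  .forced [(6146, 52, 0), (6152, 52, 0), (6272, 1164, 1), (6656, 1548, 1), (650, 2570, 1),
  (2186, 1164, 1), (2690, 1672, 1), (2696, 584, 2), (4234, 4236, 1), (4618, 584, 2),
  (4738, 2696, 1), (6154, 2062, 1), (6274, 1164, 1), (6280, 1164, 1), (6658, 526, 1),
  (6664, 584, 2), (6784, 4620, 1), (2698, 526, 1), (4746, 2698, 1), (6282, 1164, 1), (6666, 584, 2),
  (6786, 2698, 1), (6792, 652, 1), (6794, 2698, 1)] <| .cycle [0, 2, 5, 1, 4, 3]
  ) <|
  .split 3332 (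
  .forced [(138, 42, 2), (642, 322, 2), (2178, 52, 0), (2184, 1164, 0), (2688, 948, 0),
  (4106, 1292, 1), (4226, 52, 0), (4610, 1796, 1), (6146, 5122, 0), (6152, 3080, 0), (6272, 52, 0),
  (6656, 3584, 0), (650, 874, 2), (2186, 1164, 0), (2690, 948, 0), (2696, 584, 2), (4234, 4236, 0),
  (4618, 584, 2), (4738, 948, 0), (6154, 1292, 1), (6280, 1164, 0), (6658, 1796, 1), (6664, 584, 2),
  (6784, 948, 0), (2698, 584, 2), (4746, 584, 2), (6666, 584, 2), (6792, 584, 2)] <| .split 6274 (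
  .forced [(20485, 24007, 2), (20489, 24007, 2), (20492, 21826, 2), (20993, 24007, 0),
  (21000, 2698, 0), (4621, 1023, 2), (16909, 1023, 0), (20493, 24007, 2), (20997, 455, 2),
  (21001, 1023, 0), (21004, 2698, 0), (21005, 63, 2)] <| .cycle [0, 1, 2, 5, 4, 3]
  ) <|
  .split 6282 (
  .forced [(20485, 24007, 2), (20489, 24007, 0), (20492, 21826, 2), (20993, 1023, 0),
  (21000, 2698, 0), (4621, 584, 3), (16909, 1023, 0), (20493, 24007, 1), (20997, 1023, 0),
  (21001, 1023, 0), (21004, 2698, 0)] <| .split 21005 (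
  .forced [(134, 63, 0), (1030, 6148, 0), (1154, 63, 3), (1538, 1023, 3)] <|
  .bound 8198 [32767, 288] [0, 4] <| .forced [(8322, 32767, 3), (8324, 32767, 0)] <|
  .bound 8706 [25, 32767] [0, 3] <| .forced [(8708, 32767, 0)] <| .bound 8832 [32767, 288] [0, 3] <|
  .forced [(9218, 32767, 2)] <| .bound 9220 [32767, 288] [0, 4] <| .forced [(9344, 32767, 3)] <|
  .bound 9728 [25, 32767] [0, 3] <| .forced [(646, 1023, 0), (1158, 63, 3), (1542, 1023, 3),
  (1666, 21004, 2), (8326, 32767, 3), (8710, 32767, 0), (8834, 42, 4), (8836, 32767, 0),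
  (9222, 32767, 2), (9346, 32767, 3), (9348, 32767, 3), (9730, 1164, 3), (9732, 32767, 0),
  (9856, 1800, 0), (1670, 584, 4), (8838, 32767, 0), (9350, 32767, 3), (9734, 32767, 0),
  (9858, 32767, 1), (9860, 32767, 0), (9862, 32767, 1)] <| .cycle [0, 2, 1, 4, 3, 5]
  ) <|
  .cycle [0, 1, 2, 5, 4, 3]
  ) <|
  .split 6786 (
  .forced [(20485, 24007, 2), (20489, 584, 3), (20492, 2698, 2), (20993, 24007, 0),
  (21000, 2698, 0), (4621, 584, 3), (16909, 584, 3), (20493, 584, 3), (20997, 24007, 1),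
  (21001, 584, 3), (21004, 584, 3), (21005, 584, 3)] <| .cycle [0, 1, 2, 5, 4, 3]
  ) <|
  .forced [(6794, 584, 2)] <| .cycle [0, 2, 5, 1, 4, 3]
  ) <|
  .split 3336 (
  .forced [(5636, 584, 2), (5640, 800, 2), (5760, 584, 2), (1676, 948, 1), (4748, 1676, 1),
  (5644, 1800, 1), (5764, 1676, 1)] <| .split 5256 (
  .forced [(134, 52, 0), (642, 322, 3), (1030, 1164, 0), (1154, 322, 0), (1538, 522, 0),
  (8198, 13354, 0), (8322, 13354, 3), (8324, 14388, 0), (8706, 42, 3), (8708, 1676, 0),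
  (8832, 584, 0), (9218, 9224, 0), (9220, 14388, 0), (9344, 9224, 0), (9728, 584, 0),
  (646, 4740, 0), (1158, 1164, 0), (1542, 1676, 0), (1666, 584, 3), (8326, 13354, 0),
  (8710, 1676, 0), (8834, 42, 3), (8836, 1676, 0), (9222, 13354, 0)] <|
  .bound 9346 [13354, 192] [2, 3] <| .forced [(9348, 14388, 2)] <|
  .bound 9730 [42, 322, 584] [0, 2, 3] <| .forced [(9732, 1676, 0), (9856, 1672, 0), (1670, 584, 3),
  (8838, 1670, 0), (9734, 1670, 0), (9860, 1164, 2)] <| .split 9350 (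
  .forced [(20489, 15423, 3), (20492, 13354, 3), (20993, 32767, 3), (21000, 584, 4),
  (4621, 1023, 1), (16909, 32767, 1), (20493, 15423, 1), (20997, 32767, 1), (21001, 32767, 3),
  (21004, 30570, 3), (21005, 32767, 1)] <| .cycle [0, 1, 2, 5, 4, 3]
  ) <|
  .split 9858 (
  .forced [(18442, 4744, 3), (18444, 30570, 3)] <| .bound 18946 [322, 4744] [0, 3] <|
  .bound 18952 [322, 30570] [0, 4] <| .forced [(2574, 1670, 3), (16910, 1158, 3), (18446, 30570, 3),
  (18950, 1158, 3)] <| .bound 18954 [30570, 192] [1, 4] <| .forced [(18956, 1158, 3),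
  (18958, 1158, 3)] <| .cycle [0, 2, 1, 5, 4, 3]
  ) <|
  .split 9862 (
  .forced [(20489, 32767, 3), (20492, 30570, 3), (20993, 7175, 3), (21000, 26184, 0),
  (4621, 1023, 0), (16909, 32767, 0), (20493, 32767, 0), (20997, 32767, 1), (21001, 32767, 0),
  (21004, 1158, 3), (21005, 32767, 1)] <| .cycle [0, 1, 2, 5, 4, 3]
  ) <|
  .cycle [0, 2, 1, 4, 3, 5]
  ) <|
  .forced [(5260, 1164, 1), (5768, 1672, 1), (5772, 1676, 1)] <| .cycle [0, 3, 4, 1, 2, 5]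
  ) <|
  .split 3588 (
  .forced [(18442, 584, 2), (18444, 584, 2), (18952, 584, 2), (2574, 584, 2), (16910, 2574, 1),
  (18446, 2574, 1), (18950, 2566, 1), (18954, 2574, 1), (18956, 584, 2), (18958, 2574, 1)] <|
  .cycle [0, 2, 1, 5, 4, 3]
  ) <|
  .split 3592 (
  .forced [(18442, 584, 2), (18952, 584, 2), (2574, 584, 2), (16910, 584, 2), (18446, 584, 2),
  (18950, 18952, 1), (18954, 584, 2), (18956, 584, 2), (18958, 584, 2)] <| .cycle [0, 2, 1, 5, 4, 3]
  ) <|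
  .split 3840 (
  .forced [(134, 948, 0), (138, 874, 2), (8198, 52, 0), (8202, 42, 2), (8204, 780, 2),
  (8322, 656, 2), (8324, 1796, 1), (8328, 584, 2), (16514, 18946, 1), (16516, 1668, 1),
  (16520, 648, 0), (24578, 322, 2), (24580, 1796, 1), (24584, 584, 2)] <|
  .bound 24704 [27280, 576] [1, 2] <| .forced [(142, 584, 2), (8206, 584, 2), (8326, 948, 0),
  (8330, 874, 2), (8332, 584, 2), (16518, 948, 0), (16522, 42, 2), (16524, 584, 2),
  (24582, 16902, 0), (24586, 874, 2), (24588, 584, 2), (24706, 18946, 1), (24708, 27280, 1),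
  (24712, 26184, 1), (8334, 584, 2), (16526, 584, 2), (24590, 584, 2)] <|
  .bound 24710 [27280, 576] [1, 2] <| .forced [(24714, 42, 2), (24716, 584, 2), (24718, 584, 2)] <|
  .cycle [0, 2, 1, 4, 5, 3]
  ) <|
  .split 1804 (
  .forced [(4621, 584, 2), (16909, 584, 2), (20493, 584, 2), (20997, 4621, 1), (21001, 584, 2),
  (21004, 584, 2), (21005, 584, 2)] <| .cycle [0, 1, 2, 5, 4, 3]
  ) <|
  .forced [(2828, 584, 1)] <| .split 3340 (
  .forced [(5644, 1804, 1), (5764, 584, 2), (5768, 1676, 1)] <| .split 5260 (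
  .forced [(259, 193, 0), (515, 1023, 2), (769, 193, 3), (770, 322, 3)] <|
  .bound 2051 [455, 3073] [0, 2] <| .forced [(2305, 52, 0), (2306, 52, 0), (2561, 5644, 2),
  (8195, 15423, 2), (8449, 25, 3), (8450, 42, 3), (8705, 25, 3), (8706, 42, 3)] <|
  .bound 8960 [584, 192] [0, 3] <| .forced [(10241, 5128, 0), (10242, 5128, 0), (10496, 9224, 3),
  (10752, 5128, 3), (771, 656, 3), (2307, 455, 0), (2563, 1023, 2), (2817, 1676, 2),
  (2818, 1676, 2), (8451, 15423, 2)] <| .bound 8707 [25, 584] [0, 3] <| .forced [(8961, 25, 3),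
  (8962, 42, 3), (10243, 15423, 2), (10497, 11289, 0), (10498, 13354, 0), (10753, 11289, 0),
  (10754, 13354, 0), (11008, 3840, 0), (2819, 1023, 2), (10499, 15423, 2), (11009, 1676, 0),
  (11010, 1676, 0)] <| .split 8963 (
  .forced [(18446, 32767, 3), (18950, 32767, 0), (18954, 32767, 1), (18956, 32767, 0),
  (18958, 32767, 0)] <| .cycle [0, 2, 1, 5, 4, 3]
  ) <|
  .split 10755 (
  .forced [(18446, 32767, 3), (18950, 32767, 1)] <| .bound 18954 [25, 32767] [1, 3] <|
  .forced [(18956, 32767, 1), (18958, 32767, 1)] <| .cycle [0, 2, 1, 5, 4, 3]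
  ) <|
  .split 11011 (
  .forced [(18446, 32767, 3), (18950, 32767, 0), (18954, 32767, 0), (18956, 32767, 0),
  (18958, 32767, 1)] <| .cycle [0, 2, 1, 5, 4, 3]
  ) <|
  .cycle [0, 1, 5, 3, 4, 2]
  ) <|
  .forced [(5772, 1676, 1)] <| .cycle [0, 3, 4, 1, 2, 5]
  ) <|
  .split 3596 (
  .forced [(20493, 584, 2), (21001, 584, 2), (21004, 584, 2), (21005, 584, 2)] <|
  .cycle [0, 1, 2, 5, 4, 3]
  ) <|
  .split 3844 (
  .forced [(20493, 584, 2), (21001, 1804, 1), (21005, 584, 2)] <| .cycle [0, 1, 2, 5, 4, 3]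
  ) <|
  .split 3848 (
  .forced [(21001, 584, 2), (21005, 584, 2)] <| .cycle [0, 1, 2, 5, 4, 3]
  ) <|
  .split 3852 (
  .forced [(21005, 584, 2)] <| .cycle [0, 1, 2, 5, 4, 3]
  ) <|
  .cycle [0, 3, 4, 2, 1, 5]
  ) <|
  .split 304 (
  .symm [[0, 4, 3, 2, 1, 5], [5, 1, 2, 3, 4, 0], [5, 4, 3, 2, 1, 0]] <| .forced [(70, 112, 1),
  (578, 322, 0), (2054, 2066, 0), (2562, 800, 1)] <| .bound 582 [52, 800] [0, 1] <|
  .forced [(2566, 800, 1)] <| .bound 2626 [800, 2306] [0, 1] <| .bound 2628 [52, 800] [0, 1] <|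
  .bound 8262 [52, 8272] [0, 1] <| .bound 8710 [52, 800] [0, 1] <| .forced [(8770, 274, 1)] <|
  .split 2118 (
  .forced [(16905, 42, 2)] <| .bound 20485 [20, 112, 112, 4114] [0, 1, 2, 2] <|
  .forced [(20489, 280, 2), (4621, 584, 2), (16909, 280, 2), (20493, 280, 2)] <|
  .bound 20997 [800, 112, 4368] [0, 2, 2] <| .forced [(21001, 280, 2), (21004, 112, 2),
  (21005, 280, 2)] <| .cycle [0, 1, 2, 5, 4, 3]
  ) <|
  .split 10306 (
  .symm [[5, 4, 3, 2, 1, 0]] <| .forced [(644, 948, 2), (648, 584, 0), (1540, 582, 0),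
  (1544, 578, 0), (4232, 42, 2), (5128, 5122, 0), (652, 52, 2), (1164, 2118, 0), (1548, 874, 0),
  (1668, 948, 0), (1672, 274, 2), (4236, 112, 2), (5132, 2118, 1)] <|
  .bound 5256 [2178, 8464] [1, 2] <| .split 1676 (
  .forced [(20489, 32767, 1), (4621, 1023, 1), (16909, 1023, 1), (20493, 32767, 2),
  (20997, 32767, 1), (21001, 32767, 2), (21004, 30570, 1), (21005, 32767, 1)] <|
  .cycle [0, 1, 2, 5, 4, 3]
  ) <|
  .split 4748 (
  .forced [(20489, 1023, 1), (4621, 1023, 1), (16909, 20489, 2), (20493, 1023, 2),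
  (20997, 20489, 2), (21001, 1023, 2), (21004, 31668, 1), (21005, 20489, 2)] <|
  .cycle [0, 1, 2, 5, 4, 3]
  ) <|
  .split 5260 (
  .bound 20489 [15423, 8200, 4113] [1, 2, 3] <| .forced [(4621, 1023, 1), (16909, 32767, 1),
  (20493, 4236, 2), (20997, 32767, 1), (21001, 32767, 2), (21004, 30570, 1), (21005, 32767, 1)] <|
  .cycle [0, 1, 2, 5, 4, 3]
  ) <|
  .split 5644 (
  .forced [(20489, 15423, 1), (4621, 15423, 1), (16909, 20489, 2), (20493, 15423, 2),
  (20997, 20489, 2), (21001, 15423, 2), (21004, 30570, 1), (21005, 20489, 2)] <|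
  .cycle [0, 1, 2, 5, 4, 3]
  ) <|
  .bound 5772 [8200, 6144, 1676] [1, 1, 2] <| .cycle [0, 3, 4, 1, 2, 5]
  ) <|
  .split 2630 (
  .forced [(137, 800, 2), (385, 274, 2), (4232, 584, 2), (4480, 2208, 2), (8201, 274, 2),
  (8449, 8195, 2), (12296, 4368, 2), (12544, 12320, 2), (393, 42, 2), (4233, 1023, 0),
  (4361, 63, 0), (4488, 584, 2), (8329, 729, 0), (8457, 874, 0), (8577, 274, 2), (12297, 10306, 0),
  (12417, 8464, 2), (12424, 2208, 2), (12545, 14388, 0), (12552, 4368, 2), (12672, 2208, 2),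
  (4489, 1023, 0)] <| .bound 8585 [800, 1023, 146] [0, 1, 2] <| .forced [(12425, 1023, 0)] <|
  .split 4481 (
  .forced [(261, 7, 0), (16644, 22916, 3)] <| .bound 24584 [1023, 16448] [0, 2] <|
  .forced [(24832, 31668, 2), (269, 1023, 1), (8205, 1023, 0), (8453, 14388, 1), (8460, 52, 3),
  (16645, 22916, 1), (16649, 1023, 0), (16652, 1023, 0), (24581, 14388, 0), (24585, 12297, 0),
  (24588, 1023, 0), (24833, 52, 3), (24836, 7, 3)] <| .bound 24840 [656, 1023] [0, 2] <|
  .forced [(8461, 1023, 0), (16653, 1023, 2), (24589, 1023, 0), (24837, 31668, 2), (24841, 52, 3),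
  (24844, 7, 3)] <| .split 24845 (
  .forced [(772, 52, 4), (1029, 32767, 0), (1540, 32767, 0), (8960, 31668, 3), (9217, 12297, 0),
  (9728, 32767, 0), (773, 455, 2), (1285, 32767, 2), (1541, 32767, 0), (1793, 32767, 0),
  (1796, 32767, 0), (8709, 1023, 0), (8961, 1023, 0), (8964, 24589, 3), (9221, 32767, 0),
  (9473, 32767, 0), (9476, 32767, 0), (9729, 32767, 0), (9732, 32767, 0), (9984, 32767, 0),
  (1797, 32767, 3), (8965, 1023, 3), (9477, 32767, 0), (9733, 32767, 0), (9985, 32767, 0),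
  (9988, 32767, 0), (9989, 32767, 1)] <| .cycle [0, 1, 2, 4, 3, 5]
  ) <|
  .cycle [0, 1, 2, 4, 5, 3]
  ) <|
  .split 8584 (
  .forced [(4621, 1023, 2), (16909, 1023, 2), (20493, 1023, 2)] <|
  .bound 20997 [656, 1023] [1, 2] <| .forced [(21001, 1023, 2), (21004, 31668, 2),
  (21005, 1023, 2)] <| .cycle [0, 1, 2, 5, 4, 3]
  ) <|
  .split 12553 (
  .forced [(152, 8584, 3), (400, 1023, 1), (1048, 15423, 0), (1296, 15423, 3), (5128, 15423, 0),
  (5376, 10816, 0), (408, 8584, 3), (1176, 1023, 0), (1304, 15423, 0), (1416, 4481, 3),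
  (1424, 1023, 3), (4248, 1023, 3), (4376, 63, 3), (4496, 4481, 3), (5144, 15423, 0),
  (5256, 1023, 0), (5264, 408, 3), (5384, 15423, 0), (5392, 15423, 0), (5504, 408, 3),
  (1432, 4481, 3), (4504, 1023, 3), (5272, 400, 3), (5400, 15423, 1), (5512, 400, 3),
  (5520, 408, 3), (5528, 1023, 1)] <| .cycle [0, 3, 1, 4, 2, 5]
  ) <|
  .forced [(12673, 8464, 2), (12680, 2208, 2)] <| .bound 12681 [800, 4481] [1, 2] <|
  .cycle [0, 1, 4, 2, 5, 3]
  ) <|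
  .split 8774 (
  .forced [(522, 578, 0), (648, 584, 0), (2688, 10816, 0), (4106, 112, 2), (4232, 112, 2),
  (6146, 2630, 1)] <| .bound 6272 [6148, 4368, 8512] [0, 1, 2] <| .forced [(650, 52, 2),
  (2186, 112, 2), (2570, 2630, 0), (2690, 2630, 0), (2696, 10816, 0), (4234, 112, 2),
  (4618, 874, 0), (4738, 800, 2), (4744, 4240, 2), (6154, 112, 2)] <|
  .bound 6274 [52, 2630] [0, 1] <| .forced [(6280, 112, 2), (6658, 2630, 0), (6664, 10816, 0),
  (6784, 800, 2), (2698, 2630, 0), (6282, 112, 2), (6666, 2630, 1), (6786, 800, 2)] <|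
  .bound 6792 [584, 2630, 4368] [0, 1, 2] <| .split 4746 (
  .forced [(776, 656, 0), (2057, 8512, 3), (2312, 2630, 3), (4864, 874, 3)] <|
  .bound 6145 [4240, 6154] [0, 2] <| .forced [(6400, 2698, 2), (777, 1023, 0), (2313, 1023, 0),
  (2569, 1023, 0), (2817, 1023, 0), (2824, 6274, 3), (4361, 1023, 0), (4865, 1023, 0),
  (4872, 52, 3), (6153, 656, 3), (6401, 6274, 0), (6408, 2630, 0), (6657, 1023, 0),
  (6912, 10816, 0), (2825, 2630, 0), (4873, 1023, 2), (6409, 584, 3), (6665, 1023, 0),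
  (6913, 584, 3), (6920, 2630, 2)] <| .split 6921 (
  .forced [(37, 6274, 0), (548, 874, 4), (1029, 1044, 0), (1540, 1023, 0), (16417, 14388, 4),
  (16928, 584, 0), (17409, 12289, 0)] <| .bound 17920 [32767, 6272] [0, 4] <|
  .forced [(549, 1023, 0), (1061, 7175, 0), (1541, 1023, 0), (1569, 1023, 0), (1572, 1023, 0),
  (16421, 1023, 3), (16929, 1023, 0), (16932, 52, 4), (17413, 20485, 0), (17441, 22916, 0),
  (17444, 32767, 3), (17921, 32767, 0), (17924, 32767, 0), (17952, 32767, 0), (1573, 1023, 0),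
  (16933, 1023, 3), (17445, 32767, 1), (17925, 32767, 0), (17953, 32767, 0), (17956, 32767, 3),
  (17957, 32767, 1)] <| .cycle [0, 1, 2, 3, 4, 5]
  ) <|
  .cycle [0, 1, 5, 2, 4, 3]
  ) <|
  .split 6794 (
  .forced [(14, 70, 0), (18436, 12416, 0), (18944, 6784, 0), (526, 874, 0), (2062, 8768, 3),
  (2572, 2630, 0), (16398, 31668, 0), (16902, 31668, 0), (16906, 6274, 3), (18438, 14388, 0),
  (18442, 6154, 0), (18444, 31668, 0), (18946, 31668, 0), (18948, 31668, 0), (18952, 31668, 0),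
  (2574, 2630, 2), (16910, 31668, 2), (18446, 31668, 0), (18950, 31668, 0), (18954, 31668, 0),
  (18956, 31668, 0)] <| .split 18958 (
  .forced [(641, 1023, 4), (672, 656, 4), (1153, 32767, 3), (1184, 14388, 4), (4640, 874, 4),
  (5121, 8464, 4), (5152, 8464, 4), (673, 1023, 4), (1185, 32767, 3), (1569, 32767, 2),
  (1665, 32767, 3), (1696, 6274, 4), (4257, 1023, 3), (4641, 63, 0), (4737, 1023, 0),
  (4768, 31668, 4), (5153, 8464, 4), (5249, 32767, 3), (5280, 8352, 4), (5633, 32767, 2),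
  (5664, 874, 0), (5760, 2574, 3), (1697, 32767, 3), (4769, 584, 4), (5281, 32767, 3),
  (5665, 32767, 2), (5761, 32767, 3), (5792, 30570, 3), (5793, 32767, 3)] <|
  .cycle [0, 1, 4, 3, 2, 5]
  ) <|
  .cycle [0, 2, 1, 5, 4, 3]
  ) <|
  .cycle [0, 2, 5, 1, 4, 3]
  ) <|
  .split 10310 (
  .forced [(21001, 2630, 1)] <| .split 20493 (
  .forced [(548, 4620, 3), (608, 8456, 0), (1540, 15423, 0), (1600, 15423, 2), (2084, 7, 0),
  (2144, 12320, 3), (3076, 7175, 0), (3136, 17472, 0), (612, 2630, 0), (1124, 15423, 0),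
  (1572, 15423, 0), (1604, 15423, 0), (1632, 26184, 0), (2148, 63, 0), (2596, 2630, 0),
  (2656, 4368, 3), (3108, 15423, 0), (3140, 20485, 0), (3168, 15423, 2), (3588, 15423, 0),
  (3616, 26184, 0), (3648, 15423, 2), (1636, 15423, 0), (2660, 2630, 0), (3172, 15423, 2),
  (3620, 15423, 0), (3652, 15423, 2)] <| .bound 3680 [15423, 4114, 8272] [2, 2, 3] <|
  .bound 3684 [15423, 4114, 8272] [2, 2, 3] <| .cycle [0, 4, 3, 2, 1, 5]
  ) <|
  .forced [(21005, 2630, 1)] <| .cycle [0, 1, 2, 5, 4, 3]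
  ) <|
  .split 10822 (
  .symm [[5, 4, 3, 2, 1, 0]] <| .forced [(644, 2630, 2), (648, 584, 0), (1540, 2630, 0),
  (1544, 584, 0), (4232, 112, 2), (5128, 2120, 0), (652, 2630, 0), (1164, 2118, 0), (1548, 2630, 0),
  (1668, 2630, 0), (4236, 112, 2), (5132, 2118, 0)] <| .bound 5256 [280, 2208] [0, 2] <|
  .forced [(1676, 2630, 0), (4748, 2630, 0), (5644, 2630, 0)] <| .split 1672 (
  .forced [(21005, 32767, 2)] <| .cycle [0, 1, 2, 5, 4, 3]
  ) <|
  .split 5260 (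
  .forced [(21005, 32767, 2)] <| .cycle [0, 1, 2, 5, 4, 3]
  ) <|
  .split 5772 (
  .forced [(21005, 32767, 2)] <| .cycle [0, 1, 2, 5, 4, 3]
  ) <|
  .cycle [0, 3, 4, 1, 2, 5]
  ) <|
  .cycle [0, 2, 1, 5, 3, 4]
  ) <|
  .split 1296 (
  .symm [[0, 1, 4, 3, 2, 5], [0, 2, 1, 4, 3, 5], [0, 2, 3, 4, 1, 5], [0, 3, 2, 1, 4, 5],
  [0, 3, 4, 1, 2, 5], [0, 4, 1, 2, 3, 5], [0, 4, 3, 2, 1, 5], [1, 0, 2, 5, 4, 3],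
  [1, 0, 4, 5, 2, 3], [1, 2, 0, 4, 5, 3], [1, 2, 5, 4, 0, 3], [1, 4, 0, 2, 5, 3],
  [1, 4, 5, 2, 0, 3], [1, 5, 2, 0, 4, 3], [1, 5, 4, 0, 2, 3], [2, 0, 1, 5, 3, 4],
  [2, 0, 3, 5, 1, 4], [2, 1, 0, 3, 5, 4], [2, 1, 5, 3, 0, 4], [2, 3, 0, 1, 5, 4],
  [2, 3, 5, 1, 0, 4], [2, 5, 1, 0, 3, 4], [2, 5, 3, 0, 1, 4], [3, 0, 2, 5, 4, 1],
  [3, 0, 4, 5, 2, 1], [3, 2, 0, 4, 5, 1], [3, 2, 5, 4, 0, 1], [3, 4, 0, 2, 5, 1],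
  [3, 4, 5, 2, 0, 1], [3, 5, 2, 0, 4, 1], [3, 5, 4, 0, 2, 1], [4, 0, 1, 5, 3, 2],
  [4, 0, 3, 5, 1, 2], [4, 1, 0, 3, 5, 2], [4, 1, 5, 3, 0, 2], [4, 3, 0, 1, 5, 2],
  [4, 3, 5, 1, 0, 2], [4, 5, 1, 0, 3, 2], [4, 5, 3, 0, 1, 2], [5, 1, 2, 3, 4, 0],
  [5, 1, 4, 3, 2, 0], [5, 2, 1, 4, 3, 0], [5, 2, 3, 4, 1, 0], [5, 3, 2, 1, 4, 0],
  [5, 3, 4, 1, 2, 0], [5, 4, 1, 2, 3, 0], [5, 4, 3, 2, 1, 0]] <| .forced [(1540, 276, 1),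
  (2144, 112, 1), (612, 52, 1), (1124, 52, 1), (1572, 52, 1), (1604, 276, 1), (1632, 304, 1),
  (2148, 112, 1), (2628, 1604, 0), (3140, 336, 1), (3168, 2096, 1), (1636, 276, 1), (2660, 1636, 0),
  (3172, 112, 1)] <| .split 3652 (
  .symm [[5, 4, 3, 2, 1, 0]] <| .forced [(9734, 2642, 2), (9862, 1670, 2)] <|
  .cycle [0, 2, 1, 4, 3, 5]
  ) <|
  .forced [(3684, 304, 1)] <| .cycle [0, 4, 3, 2, 1, 5]
  ) <|
  .split 368 (
  .symm [[1, 0, 2, 4, 3, 5]] <| .split 424 (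
  .symm [[0, 1, 2, 4, 3, 5], [1, 0, 2, 3, 4, 5], [1, 0, 2, 4, 3, 5]] <| .forced [(773, 729, 0),
  (1541, 729, 0), (1793, 729, 0), (1796, 948, 0), (8709, 729, 0), (8961, 729, 0), (8964, 948, 0),
  (9729, 729, 0), (9732, 948, 0)] <| .split 1285 (
  .forced [(2307, 63, 1), (8451, 63, 1), (10243, 63, 1), (10497, 11289, 1), (10498, 63, 1)] <|
  .bound 11008 [729, 1216] [0, 1] <| .forced [(2819, 1023, 1), (8963, 63, 1), (10499, 63, 1),
  (10755, 63, 1), (11010, 63, 1)] <| .split 11009 (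
  .forced [(2083, 63, 2), (16419, 1023, 2), (18435, 1023, 2), (18465, 28377, 2),
  (18466, 1023, 2)] <| .bound 18976 [28377, 1048] [0, 4] <| .forced [(2595, 1023, 2),
  (16931, 63, 2), (18467, 1023, 2), (18947, 63, 2), (18977, 28377, 1), (18978, 63, 2),
  (18979, 63, 2)] <| .cycle [0, 1, 5, 4, 3, 2]
  ) <|
  .forced [(11011, 63, 1)] <| .cycle [0, 1, 5, 3, 4, 2]
  ) <|
  .split 8453 (
  .forced [(674, 1023, 3), (1186, 63, 0), (1570, 1023, 0), (1666, 1023, 0), (1696, 729, 1),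
  (2210, 63, 1), (2690, 1023, 1), (2720, 729, 1), (3106, 63, 0)] <| .bound 3202 [25, 63] [0, 1] <|
  .forced [(3232, 11289, 1), (3586, 1023, 0), (3616, 729, 1), (3712, 729, 1), (1698, 729, 1),
  (2722, 1023, 1), (3618, 729, 1), (3714, 729, 1), (3744, 729, 1)] <| .split 3234 (
  .forced [(673, 729, 4), (1185, 63, 2), (1665, 1023, 2), (4257, 15423, 2), (4641, 1023, 2),
  (4737, 1023, 2), (4768, 1023, 4), (5153, 15423, 0), (5249, 15423, 0), (5280, 15423, 0),
  (5633, 1023, 0), (5664, 2817, 2), (5760, 2593, 2), (1697, 1023, 2), (4769, 1023, 2),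
  (5281, 15423, 1), (5665, 1023, 1), (5761, 1023, 1), (5792, 729, 2), (5793, 729, 2)] <|
  .cycle [0, 1, 4, 3, 2, 5]
  ) <|
  .forced [(3746, 729, 1)] <| .cycle [0, 2, 3, 4, 1, 5]
  ) <|
  .bound 9221 [1061, 8336] [0, 2] <| .split 9473 (
  .forced [(10497, 11289, 1), (10498, 11289, 1), (11008, 729, 3), (2819, 729, 1), (8963, 729, 1),
  (10499, 11289, 1), (10755, 2819, 1), (11009, 729, 1), (11010, 2819, 1), (11011, 2819, 1)] <|
  .cycle [0, 1, 5, 3, 4, 2]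
  ) <|
  .split 9476 (
  .forced [(609, 729, 3), (2145, 11289, 0), (2625, 729, 0), (2656, 948, 3), (4193, 1061, 0),
  (4641, 729, 0), (4673, 729, 0), (4704, 948, 3), (6177, 11289, 1)] <|
  .bound 6209 [11289, 8480] [1, 3] <| .forced [(6240, 14388, 1), (6657, 729, 0), (6688, 948, 1),
  (6720, 948, 0)] <| .bound 2657 [729, 8480] [1, 3] <| .bound 4705 [729, 8480] [1, 3] <|
  .bound 6241 [11289, 8480] [1, 3] <| .forced [(6689, 6241, 0), (6721, 4705, 0)] <|
  .bound 6752 [948, 8480] [1, 3] <| .bound 6753 [2657, 8480] [1, 3] <| .cycle [0, 1, 5, 2, 3, 4]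
  ) <|
  .split 9984 (
  .forced [(17952, 26184, 1)] <| .bound 16933 [26184, 1216] [1, 3] <| .forced [(17445, 26184, 3),
  (17925, 16933, 0)] <| .bound 17953 [729, 1216] [1, 3] <| .bound 17956 [948, 1216] [1, 3] <|
  .split 1573 (
  .forced [(18976, 26184, 4), (2595, 1023, 1), (16931, 1023, 1), (18467, 1023, 1), (18947, 1023, 1),
  (18977, 28377, 4), (18978, 1023, 4), (18979, 1023, 1)] <| .cycle [0, 1, 5, 4, 3, 2]
  ) <|
  .bound 17957 [26184, 1216] [1, 3] <| .cycle [0, 1, 2, 3, 4, 5]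
  ) <|
  .split 1797 (
  .forced [(2819, 1023, 1), (8963, 1023, 1), (10499, 1023, 1), (10755, 1023, 1),
  (11010, 1023, 1)] <| .split 11009 (
  .forced [(2595, 1023, 2), (16931, 1023, 2), (18467, 1023, 2), (18947, 1023, 2), (18977, 28377, 2),
  (18978, 1023, 2), (18979, 1023, 2)] <| .cycle [0, 1, 5, 4, 3, 2]
  ) <|
  .forced [(11011, 1023, 1)] <| .cycle [0, 1, 5, 3, 4, 2]
  ) <|
  .split 8965 (
  .forced [(646, 1023, 0)] <| .bound 1158 [63, 88] [0, 3] <| .forced [(1542, 1023, 0),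
  (1666, 1023, 0), (1668, 1573, 0)] <| .bound 8326 [1023, 88] [0, 3] <| .forced [(8710, 1023, 0),
  (8834, 1023, 0), (8836, 729, 0)] <| .bound 9222 [1023, 88, 8480] [0, 3, 3] <|
  .forced [(9346, 9222, 0), (9348, 9221, 0), (9730, 1023, 0), (9856, 1573, 1), (1670, 1023, 0),
  (8838, 1023, 1)] <| .bound 9350 [1023, 88] [0, 3] <| .forced [(9734, 1023, 0), (9858, 1023, 0),
  (9860, 1573, 1)] <| .split 9862 (
  .forced [(643, 1023, 0), (4227, 63, 0), (4611, 1023, 0), (4737, 1023, 0), (4738, 1023, 0),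
  (8323, 1023, 0), (8833, 729, 0)] <| .bound 12291 [1023, 8264] [0, 4] <| .forced [(12417, 9858, 2),
  (12418, 1023, 0), (12801, 1023, 0), (12802, 1023, 0), (12928, 1023, 2), (4739, 1023, 0),
  (8835, 1023, 2), (12419, 1023, 0), (12803, 1023, 0), (12929, 1023, 2), (12930, 1023, 0)] <|
  .split 12931 (
  .forced [(16931, 1023, 3), (18467, 32767, 3), (18947, 32767, 3), (18977, 32767, 2),
  (18978, 32767, 3), (18979, 32767, 3)] <| .cycle [0, 1, 5, 4, 3, 2]
  ) <|
  .cycle [0, 1, 4, 3, 5, 2]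
  ) <|
  .cycle [0, 2, 1, 4, 3, 5]
  ) <|
  .split 9477 (
  .forced [(10755, 1023, 1), (11009, 1573, 1), (11010, 1023, 1)] <| .split 10499 (
  .forced [(673, 1023, 4), (1185, 63, 0), (1665, 1023, 0), (1696, 1023, 2), (4257, 15423, 0),
  (4641, 1023, 0), (4737, 1023, 0), (4768, 1023, 2), (5153, 15423, 0), (5249, 15423, 0),
  (5280, 15423, 2), (5633, 1023, 0), (5664, 1023, 2), (5760, 1023, 2), (1697, 1023, 2),
  (4769, 1023, 2), (5281, 15423, 2), (5665, 1023, 2), (5761, 1023, 2), (5792, 1023, 2),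
  (5793, 1023, 2)] <| .cycle [0, 1, 4, 3, 2, 5]
  ) <|
  .forced [(11011, 1023, 1)] <| .cycle [0, 1, 5, 3, 4, 2]
  ) <|
  .forced [(9733, 1573, 0)] <| .split 9985 (
  .forced [(18977, 28377, 1), (18978, 28377, 1), (18979, 28377, 1)] <| .cycle [0, 1, 5, 4, 3, 2]
  ) <|
  .split 9988 (
  .forced [(531, 1023, 0), (4115, 1023, 1), (4611, 1023, 0), (4625, 1573, 0), (4626, 874, 0),
  (16403, 8965, 1), (16913, 1573, 0), (16914, 874, 0), (20483, 9733, 1), (20497, 17445, 1)] <|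
  .bound 20498 [30570, 88] [0, 3] <| .forced [(20993, 1573, 0), (20994, 30570, 0),
  (21008, 17952, 0), (4627, 1023, 1), (16915, 1023, 1), (20499, 1023, 1), (20995, 1023, 1),
  (21009, 1573, 1), (21010, 30570, 1), (21011, 1023, 1)] <| .cycle [0, 1, 3, 4, 5, 2]
  ) <|
  .split 9989 (
  .split 11011 (
  .forced [(525, 1023, 0), (4109, 7175, 0), (4613, 1023, 0), (4617, 1023, 0), (4620, 874, 0),
  (16397, 11289, 0), (16905, 1023, 0), (16908, 874, 0)] <| .bound 20485 [32767, 8336] [0, 4] <|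
  .bound 20489 [32767, 24640] [0, 4] <| .forced [(20492, 32767, 2), (20993, 32767, 0),
  (20996, 874, 0), (21000, 32767, 2), (4621, 1023, 0), (16909, 1023, 0)] <|
  .bound 20493 [32767, 88] [0, 4] <| .forced [(20997, 32767, 0), (21001, 32767, 0),
  (21004, 32767, 2), (21005, 32767, 2)] <| .cycle [0, 1, 2, 5, 4, 3]
  ) <|
  .cycle [0, 1, 5, 3, 4, 2]
  ) <|
  .cycle [0, 1, 2, 4, 3, 5]
  ) <|
  .bound 1192 [176, 424] [0, 1] <| .split 1320 (
  .forced [(643, 424, 1), (4227, 424, 1)] <| .bound 4611 [800, 874] [0, 1] <|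
  .forced [(4737, 729, 1), (4738, 874, 1), (8323, 424, 2), (8707, 874, 0), (8833, 424, 2),
  (8834, 424, 2)] <| .bound 12291 [9224, 13354] [0, 2] <| .forced [(12417, 424, 2),
  (12418, 13354, 2), (12802, 874, 0), (12928, 424, 2), (4739, 424, 1), (8835, 424, 2),
  (12419, 424, 2), (12930, 424, 2)] <| .split 12801 (
  .forced [(650, 4739, 3), (2186, 8707, 1), (2570, 874, 3), (2690, 4739, 0), (2696, 729, 0),
  (4234, 4739, 1), (4618, 874, 3), (4744, 729, 3), (6154, 874, 1), (6274, 12802, 1), (6280, 424, 0),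
  (6658, 874, 3), (6664, 11289, 3), (6784, 729, 0), (2698, 874, 3), (4746, 4739, 3), (6282, 874, 1),
  (6666, 874, 3), (6786, 874, 3)] <| .split 6792 (
  .forced [(526, 63, 4), (2062, 1023, 4), (2566, 1023, 4), (2572, 729, 4), (16398, 32767, 4),
  (16902, 32767, 4), (16906, 28377, 4), (16908, 28377, 4), (18438, 32767, 0), (18442, 28377, 0),
  (18444, 28377, 0), (18946, 28377, 0), (18948, 28377, 0), (18952, 28377, 0), (2574, 1023, 4),
  (16910, 32767, 4), (18446, 32767, 1), (18950, 32767, 1), (18954, 874, 4), (18956, 28377, 1),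
  (18958, 32767, 1)] <| .cycle [0, 2, 1, 5, 4, 3]
  ) <|
  .forced [(6794, 874, 3)] <| .cycle [0, 2, 5, 1, 4, 3]
  ) <|
  .split 12803 (
  .forced [(163, 424, 3), (8227, 874, 0), (8353, 4739, 3), (8354, 4739, 3), (16419, 30570, 0),
  (16515, 30570, 0), (16545, 30570, 0), (16546, 30570, 0), (24579, 30570, 0), (24609, 30570, 0),
  (24610, 30570, 0), (24705, 12417, 0), (24706, 30570, 0), (24736, 26184, 0), (8355, 424, 3),
  (16547, 30570, 0), (24611, 30570, 1), (24707, 30570, 0), (24737, 30570, 0), (24738, 30570, 0)] <|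
  .split 24739 (
  .forced [(526, 63, 0), (2062, 32767, 2), (2566, 32767, 0), (2570, 28377, 4), (2572, 32767, 4),
  (16398, 1023, 0), (16902, 1023, 0), (16906, 30570, 0), (16908, 1023, 0), (18438, 32767, 0),
  (18442, 28377, 0), (18444, 32767, 0), (18946, 28377, 0), (18948, 32767, 0), (18952, 26184, 0),
  (2574, 32767, 2), (16910, 1023, 2), (18446, 32767, 0), (18950, 32767, 0), (18954, 28377, 0),
  (18956, 32767, 0), (18958, 32767, 1)] <| .cycle [0, 2, 1, 5, 4, 3]
  ) <|
  .cycle [0, 1, 4, 5, 3, 2]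
  ) <|
  .forced [(12929, 424, 2), (12931, 424, 2)] <| .cycle [0, 1, 4, 3, 5, 2]
  ) <|
  .split 1416 (
  .forced [(226, 424, 1), (2146, 226, 2), (2210, 226, 2), (2242, 2440, 1), (2272, 2464, 2),
  (8290, 226, 2), (8354, 226, 2), (8386, 226, 2), (8416, 424, 2), (10274, 226, 2), (10306, 226, 2),
  (10336, 424, 2), (10370, 226, 2), (10400, 424, 2), (10432, 424, 2), (2274, 226, 2),
  (8418, 226, 2), (10338, 2274, 2), (10402, 2274, 2), (10434, 2274, 2), (10464, 424, 2),
  (10466, 2274, 2)] <| .cycle [0, 2, 3, 5, 1, 4]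
  ) <|
  .split 1440 (
  .forced [(526, 424, 2), (2062, 424, 2), (2566, 948, 0), (2570, 874, 2), (2572, 424, 2),
  (16398, 424, 2), (16902, 948, 0), (16906, 424, 2), (16908, 948, 0)] <|
  .bound 18438 [17472, 2464] [0, 2] <| .forced [(18442, 2216, 2), (18444, 424, 2), (18946, 2464, 2),
  (18948, 948, 0), (18952, 424, 2), (2574, 424, 2), (16910, 424, 2), (18446, 424, 2),
  (18954, 424, 2), (18956, 424, 2)] <| .split 18950 (
  .bound 525 [1023, 2216] [0, 3] <| .forced [(4109, 63, 0), (4613, 24007, 0), (4617, 1023, 3),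
  (4620, 2574, 0), (16397, 1023, 0), (16901, 455, 0), (16905, 1023, 1), (20485, 24007, 1),
  (20489, 1023, 3), (20492, 2574, 0), (20993, 24007, 0), (20996, 948, 0), (21000, 424, 3),
  (4621, 1023, 1), (16909, 1023, 1), (20493, 1023, 1), (20997, 24007, 1), (21001, 63, 3),
  (21004, 424, 3), (21005, 1023, 1)] <| .cycle [0, 1, 2, 5, 4, 3]
  ) <|
  .forced [(18958, 424, 2)] <| .cycle [0, 2, 1, 5, 4, 3]
  ) <|
  .split 3112 (
  .bound 178 [424, 2096] [1, 2] <| .forced [(1074, 1320, 1), (1170, 424, 2), (1186, 424, 2),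
  (1200, 1416, 2), (16434, 1074, 1), (16530, 178, 2), (16546, 178, 2), (16560, 1192, 1),
  (17426, 1074, 1), (17442, 1074, 1), (17456, 1320, 2), (17538, 424, 2), (17552, 424, 2),
  (17568, 424, 2), (1202, 424, 2), (16562, 178, 2), (17458, 1074, 1), (17554, 16560, 2),
  (17570, 424, 2), (17584, 1416, 2), (17586, 17456, 1)] <| .cycle [0, 2, 3, 1, 4, 5]
  ) <|
  .split 3208 (
  .symm [[1, 0, 2, 4, 3, 5], [3, 4, 5, 1, 0, 2], [4, 3, 5, 0, 1, 2]] <| .forced [(408, 424, 2),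
  (1176, 2464, 2), (1304, 2216, 1), (1424, 232, 2), (4248, 232, 2), (4376, 344, 2), (4488, 232, 2),
  (4496, 240, 2), (5144, 1176, 1), (5256, 240, 2), (5384, 2248, 1), (5392, 344, 2), (5504, 232, 2),
  (1432, 240, 2), (4504, 4432, 2), (5520, 1176, 1), (5272, 6168, 1), (5400, 1232, 1),
  (5512, 240, 2), (5528, 2136, 1)] <| .cycle [0, 3, 1, 4, 2, 5]
  ) <|
  .bound 3232 [176, 1072, 1440] [0, 0, 1] <| .split 3360 (
  .symm [[1, 0, 2, 4, 3, 5]] <| .forced [(142, 424, 2), (8206, 1320, 1), (8326, 1440, 1),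
  (8330, 424, 2), (8332, 424, 2), (24586, 1320, 1), (24588, 1320, 1), (24712, 424, 2),
  (8334, 424, 2), (24714, 424, 2)] <| .split 24582 (
  .forced [(652, 8334, 3), (1164, 424, 3), (1548, 874, 0), (1668, 948, 0), (1672, 2440, 3),
  (4236, 424, 3), (4620, 24588, 0), (4740, 24708, 0), (4744, 424, 3), (5132, 1320, 2),
  (5252, 1440, 2), (5256, 3208, 0), (5636, 14388, 2), (5640, 1320, 0), (5760, 2464, 0),
  (1676, 16526, 0), (4748, 16526, 0), (5260, 424, 3)] <| .bound 5644 [30570, 8480] [2, 3] <|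
  .bound 5764 [31668, 8480] [2, 3] <| .bound 5768 [30570, 8480] [1, 3] <|
  .bound 5772 [30570, 8480] [2, 3] <| .cycle [0, 3, 4, 1, 2, 5]
  ) <|
  .forced [(24590, 1320, 1), (24718, 424, 2)] <| .cycle [0, 2, 1, 4, 5, 3]
  ) <|
  .split 1448 (
  .forced [(394, 424, 2), (2186, 3360, 2), (2314, 394, 2), (2434, 2464, 2)] <|
  .bound 8330 [82, 394] [0, 2] <| .forced [(8458, 394, 0), (8578, 394, 2), (8584, 424, 0),
  (10250, 2434, 2), (10370, 394, 2), (10376, 2464, 2), (10498, 394, 2), (10504, 2464, 2),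
  (10624, 3112, 2), (2442, 3360, 2), (10378, 2442, 1), (10506, 2434, 2), (10626, 2442, 2),
  (10632, 2464, 2)] <| .split 8586 (
  .forced [(780, 874, 3), (1292, 394, 0), (1548, 874, 0), (1796, 874, 3), (1800, 874, 0),
  (2316, 2442, 0), (2572, 1416, 3), (2820, 948, 0), (2824, 2442, 3), (3084, 2186, 0),
  (3332, 1416, 3), (3588, 2442, 0), (3592, 10626, 2), (3840, 2442, 3), (1804, 948, 3),
  (2828, 874, 3), (3340, 2442, 0), (3596, 1804, 0), (3844, 874, 3), (3848, 2434, 3)] <|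
  .split 3852 (
  .forced [(525, 1023, 4), (4109, 1023, 0), (4613, 455, 0), (4617, 1023, 4), (4620, 1804, 0),
  (16397, 1023, 4), (16901, 455, 4), (16905, 729, 4), (16908, 1804, 4), (20485, 32767, 1),
  (20489, 32767, 4), (20492, 30570, 0), (20993, 32767, 3), (20996, 948, 0), (21000, 30570, 4),
  (4621, 729, 4), (16909, 1023, 4), (20493, 32767, 0), (20997, 32767, 1), (21001, 32767, 4),
  (21004, 874, 4), (21005, 729, 4)] <| .cycle [0, 1, 2, 5, 4, 3]
  ) <|
  .cycle [0, 3, 4, 2, 1, 5]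
  ) <|
  .forced [(10634, 2442, 1)] <| .cycle [0, 2, 4, 1, 5, 3]
  ) <|
  .split 3240 (
  .bound 582 [52, 1448] [0, 1] <| .forced [(2118, 2464, 0), (2566, 1448, 1), (2626, 2464, 0),
  (2628, 1448, 1)] <| .bound 8262 [52, 1448] [0, 1] <| .forced [(8710, 874, 0), (8770, 874, 0),
  (8772, 1448, 1), (10246, 1448, 1), (10306, 424, 2), (10308, 1448, 0), (10754, 1448, 0),
  (10756, 1192, 0), (10816, 1448, 2)] <| .bound 2630 [656, 1448] [1, 2] <| .forced [(10310, 424, 2),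
  (10758, 424, 2), (10818, 424, 2), (10820, 424, 2)] <| .split 8774 (
  .forced [(226, 424, 3), (2146, 1448, 0), (2210, 1448, 0), (2242, 1448, 0), (2272, 1448, 0),
  (8290, 874, 3), (8354, 874, 3), (8386, 874, 3), (8416, 424, 3), (10274, 2472, 2),
  (10336, 1448, 3), (10370, 1448, 0), (10400, 1320, 3), (10432, 1320, 3), (2274, 1448, 0),
  (8418, 874, 3), (10338, 424, 3), (10402, 1448, 2), (10434, 1448, 0), (10464, 1320, 3)] <|
  .split 10466 (
  .forced [(394, 1448, 4), (2186, 1448, 0), (2314, 1448, 0), (2434, 1448, 0), (8330, 1448, 4),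
  (8458, 874, 4), (8578, 1448, 4), (8584, 424, 4), (10250, 10818, 3)] <|
  .bound 10376 [52, 1448] [0, 4] <| .forced [(10498, 10758, 2), (10504, 1448, 4), (10624, 874, 4),
  (2442, 1448, 0), (8586, 1448, 4), (10378, 1448, 3), (10506, 424, 4), (10626, 1448, 0),
  (10632, 874, 4)] <| .split 10634 (
  .forced [(114, 874, 5), (2098, 1448, 0), (2130, 1448, 0), (2160, 1448, 5), (16434, 1448, 5),
  (16466, 1448, 5), (16482, 1448, 5), (16496, 424, 5), (18450, 1448, 0), (18466, 10506, 4),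
  (18480, 874, 5), (18498, 10250, 0), (18512, 1448, 0), (18528, 1448, 0), (2162, 424, 5),
  (16498, 1448, 5), (18482, 1448, 4), (18514, 1448, 0), (18530, 1448, 0), (18544, 874, 5)] <|
  .split 18546 (
  .forced [(393, 1023, 6), (4233, 32767, 4), (4361, 32767, 5), (4481, 32767, 0), (4488, 30570, 6),
  (8329, 1023, 6), (8457, 63, 6), (8577, 1023, 6), (12297, 32767, 3), (12417, 32767, 4),
  (12424, 30570, 6), (12545, 32767, 5), (12552, 874, 6), (12672, 30570, 6), (4489, 32767, 5),
  (8585, 1023, 6), (12425, 32767, 4), (12553, 32767, 5), (12673, 32767, 5), (12680, 30570, 6),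
  (12681, 32767, 5)] <| .cycle [0, 1, 4, 2, 5, 3]
  ) <|
  .cycle [0, 2, 3, 1, 5, 4]
  ) <|
  .cycle [0, 2, 4, 1, 5, 3]
  ) <|
  .cycle [0, 2, 3, 5, 1, 4]
  ) <|
  .forced [(10822, 424, 2)] <| .cycle [0, 2, 1, 5, 3, 4]
  ) <|
  .split 3368 (
  .forced [(646, 948, 0), (1158, 2472, 1), (1542, 874, 0), (1666, 424, 2), (1668, 1448, 0),
  (8326, 424, 2), (8710, 874, 0), (8834, 424, 2), (8836, 424, 2)] <|
  .bound 9222 [22, 88, 1320] [0, 0, 2] <| .forced [(9346, 3240, 1), (9348, 1448, 1), (9730, 874, 0),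
  (9732, 1320, 0), (9856, 3240, 1), (1670, 424, 2), (8838, 424, 2), (9350, 1448, 1),
  (9858, 1448, 1), (9860, 1448, 1)] <| .split 9734 (
  .forced [(643, 1448, 2), (4227, 455, 0), (4611, 15423, 1), (4737, 1023, 2), (4738, 1448, 2),
  (8323, 1023, 0), (8707, 63, 0), (8833, 1448, 3), (12291, 15423, 1), (12417, 424, 3),
  (12418, 1448, 0), (12801, 15423, 0), (12802, 874, 0), (12928, 1448, 3), (4739, 1023, 1),
  (8835, 1023, 1), (12419, 1023, 1), (12803, 15423, 1), (12929, 424, 3), (12930, 424, 3),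
  (12931, 1023, 1)] <| .cycle [0, 1, 4, 3, 5, 2]
  ) <|
  .forced [(9862, 1448, 1)] <| .cycle [0, 2, 1, 4, 3, 5]
  ) <|
  .split 3496 (
  .symm [[1, 0, 2, 4, 3, 5]] <| .forced [(646, 948, 0)] <| .bound 1158 [88, 1448] [0, 2] <|
  .forced [(1542, 874, 0)] <| .bound 1666 [648, 1448] [0, 2] <| .forced [(1668, 1448, 0),
  (8326, 424, 2), (8710, 874, 0), (8834, 424, 2), (8836, 424, 2), (9346, 3208, 0)] <|
  .bound 9348 [2464, 8336] [0, 2] <| .forced [(9730, 874, 0), (9732, 1320, 0)] <|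
  .bound 9856 [1448, 2240] [0, 2] <| .forced [(1670, 424, 2), (8838, 424, 2)] <|
  .bound 9350 [22, 88, 208, 1448, 1448] [0, 0, 0, 2, 2] <| .forced [(9858, 1448, 0),
  (9860, 1448, 0)] <| .split 9222 (
  .forced [(142, 9350, 0)] <| .bound 8206 [1320, 9350] [1, 2] <| .forced [(8330, 9350, 0)] <|
  .bound 8332 [2084, 9350, 9350] [0, 1, 3] <| .forced [(16518, 8206, 1), (16522, 1320, 3),
  (16524, 9350, 0), (24582, 424, 3), (24586, 9350, 1), (24588, 9350, 1), (24706, 9350, 0),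
  (24708, 9350, 0)] <| .bound 24712 [8272, 8272, 16672, 18446] [0, 0, 1, 3] <|
  .forced [(8334, 9350, 0), (16526, 8334, 0), (24590, 8334, 1), (24710, 8206, 1), (24714, 8334, 0),
  (24716, 8334, 0)] <| .split 24718 (
  .forced [(643, 24582, 2), (4227, 16518, 0), (4611, 32767, 1)] <|
  .bound 4737 [32767, 16672] [2, 4] <| .forced [(4738, 24582, 2), (8323, 8334, 0), (8707, 63, 0),
  (8833, 1023, 4), (12291, 8206, 2), (12417, 8334, 0), (12418, 8334, 2), (12801, 32767, 3),
  (12802, 874, 2), (12928, 1448, 4), (4739, 24582, 2), (8835, 9350, 0), (12419, 24710, 0),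
  (12803, 32767, 1), (12929, 32767, 0), (12930, 18446, 0)] <| .bound 12931 [32767, 8480] [2, 4] <|
  .cycle [0, 1, 4, 3, 5, 2]
  ) <|
  .cycle [0, 2, 1, 4, 5, 3]
  ) <|
  .split 9734 (
  .forced [(169, 1448, 3), (4137, 63, 0), (4233, 1448, 0), (4257, 1023, 1), (4264, 1448, 3),
  (16425, 1023, 3), (16521, 1542, 3), (16545, 455, 0), (16552, 424, 0), (20489, 32767, 1),
  (20513, 32767, 1), (20520, 1448, 3), (20609, 32767, 2), (20616, 1448, 0), (20640, 2464, 0),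
  (4265, 1023, 1), (16553, 63, 3), (20521, 32767, 1), (20617, 32767, 0), (20641, 32767, 2),
  (20648, 1320, 3), (20649, 32767, 2)] <| .cycle [0, 1, 4, 5, 2, 3]
  ) <|
  .split 9862 (
  .forced [(18958, 424, 3)] <| .cycle [0, 2, 1, 5, 4, 3]
  ) <|
  .cycle [0, 2, 1, 4, 3, 5]
  ) <|
  .cycle [0, 3, 2, 4, 1, 5]
  ) <|
  .split 1136 (
  .symm [[0, 1, 2, 3, 5, 4], [0, 2, 1, 3, 4, 5], [0, 2, 1, 3, 5, 4], [3, 4, 5, 0, 1, 2],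
  [3, 4, 5, 0, 2, 1], [3, 5, 4, 0, 1, 2], [3, 5, 4, 0, 2, 1]] <| .forced [(1298, 114, 1),
  (1554, 114, 1), (2322, 114, 1), (2578, 114, 1), (2818, 114, 1), (3344, 368, 0), (1810, 114, 1),
  (2834, 114, 1), (3346, 114, 1), (3602, 114, 1), (3858, 114, 1)] <| .cycle [0, 2, 4, 3, 1, 5]
  ) <|
  .split 1328 (
  .symm [[0, 4, 3, 2, 1, 5], [5, 1, 2, 3, 4, 0], [5, 4, 3, 2, 1, 0]] <| .forced [(4177, 5137, 0),
  (4432, 368, 1), (12368, 368, 1), (4433, 5168, 1), (12369, 5168, 1), (12561, 305, 1),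
  (12625, 5168, 1)] <| .cycle [0, 1, 3, 5, 2, 4]
  ) <|
  .split 1392 (
  .symm [[3, 5, 4, 0, 2, 1]] <| .split 4739 (
  .bound 8334 [1023, 408] [1, 2] <| .forced [(16526, 1023, 1), (24590, 1023, 1), (24714, 30570, 2),
  (24716, 1023, 2)] <| .split 24710 (
  .forced [(1448, 1023, 2), (2472, 32767, 2), (3240, 32767, 2), (3368, 32767, 2), (3464, 32767, 2),
  (3488, 24007, 2), (3496, 32767, 2)] <| .cycle [0, 3, 2, 4, 1, 5]
  ) <|
  .forced [(24718, 1023, 1)] <| .cycle [0, 2, 1, 4, 5, 3]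
  ) <|
  .split 8835 (
  .symm [[3, 2, 1, 0, 4, 5]] <| .forced [(1676, 1023, 2), (4748, 4739, 0)] <|
  .bound 5260 [1023, 337] [0, 1] <| .forced [(5644, 1023, 0), (5764, 4739, 0), (5768, 4739, 1)] <|
  .split 5772 (
  .forced [(2156, 1023, 0), (16492, 1023, 3), (18476, 32767, 0), (18508, 32767, 0),
  (18532, 32767, 0), (18536, 32767, 3), (18540, 32767, 1)] <| .cycle [0, 3, 2, 1, 5, 4]
  ) <|
  .cycle [0, 3, 4, 1, 2, 5]
  ) <|
  .split 12419 (
  .forced [(2574, 4739, 1), (16910, 1023, 1)] <| .bound 18446 [15423, 1176] [1, 2] <|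
  .forced [(18950, 24007, 1), (18954, 28377, 2), (18956, 32767, 2), (18958, 32767, 1)] <|
  .cycle [0, 2, 1, 5, 4, 3]
  ) <|
  .split 12931 (
  .symm [[3, 5, 4, 0, 2, 1]] <| .forced [(2574, 4739, 0), (16910, 1023, 0), (18446, 32767, 0),
  (18950, 24007, 0), (18958, 32767, 1)] <| .cycle [0, 2, 1, 5, 4, 3]
  ) <|
  .cycle [0, 1, 4, 3, 5, 2]
  ) <|
  .split 3440 (
  .symm [[0, 2, 1, 3, 5, 4], [1, 0, 2, 4, 3, 5], [1, 2, 0, 4, 5, 3], [2, 0, 1, 5, 3, 4],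
  [2, 1, 0, 5, 4, 3], [3, 4, 5, 0, 1, 2], [3, 5, 4, 0, 2, 1], [4, 3, 5, 1, 0, 2],
  [4, 5, 3, 1, 2, 0], [5, 3, 4, 2, 0, 1], [5, 4, 3, 2, 1, 0]] <| .split 3684 (
  .symm [[0, 1, 3, 2, 4, 5], [5, 4, 2, 3, 1, 0], [5, 4, 3, 2, 1, 0]] <| .split 5528 (
  .forced [(24739, 32767, 3)] <| .cycle [0, 1, 4, 5, 3, 2]
  ) <|
  .cycle [0, 3, 1, 4, 2, 5]
  ) <|
  .cycle [0, 4, 3, 2, 1, 5]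
  ) <|
  .cycle [0, 4, 2, 3, 1, 5]

set_option maxRecDepth 100000 in
theorem check_refutationSix : refutationSix.check 6 (.initial 6) = true := by
  decide +kernel

/-! ### From the graph to the set system -/

section Graph

variable {V : Type*}

/-- In a 2-connected induced subgraph with one vertex deleted, a property that passes along edges
holds for all vertices as soon as it holds for one. -/
theorem IsTwoConnected.propagate {G : SimpleGraph V} {B : Set V}
    (h : IsTwoConnected (G.induce B)) {w : V} (hw : w ∈ B) {p : V → Prop}
    (hp : ∀ u ∈ B, ∀ v ∈ B, u ≠ w → v ≠ w → G.Adj u v → p u → p v) {a b : V} (ha : a ∈ B)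
    (hb : b ∈ B) (haw : a ≠ w) (hbw : b ≠ w) (hpa : p a) : p b := by
  have hconn := h.2.2 ⟨w, hw⟩
  obtain ⟨q⟩ := hconn.preconnected ⟨⟨a, ha⟩, fun e => haw (congrArg Subtype.val e)⟩
    ⟨⟨b, hb⟩, fun e => hbw (congrArg Subtype.val e)⟩
  have key : ∀ {c d : ({⟨w, hw⟩}ᶜ : Set B)},
      ((G.induce B).induce {⟨w, hw⟩}ᶜ).Walk c d → p c.1.1 → p d.1.1 := by
    intro c d q
    induction q with
    | nil => exact id
    | @cons c c' _ hadj _ ih =>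
      exact fun hc => ih (hp _ c.1.2 _ c'.1.2 (fun e => c.2 (Subtype.ext e))
        (fun e => c'.2 (Subtype.ext e)) hadj hc)
  exact key q hpa

theorem mem_superNbhd [Finite V] {G : SimpleGraph V} {Y A : Set V} {y : V} :
    y ∈ superNbhd G Y A ↔ y ∈ Y ∧ ∃ a ∈ A, ∃ b ∈ A, a ≠ b ∧ G.Adj y a ∧ G.Adj y b := by
  rw [superNbhd, Set.mem_ofPred_eq, ← Nat.lt_iff_add_one_le, Set.one_lt_ncard (Set.toFinite _)]
  refine and_congr_right fun _ => ⟨?_, ?_⟩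
  · rintro ⟨a, ⟨h1, h2⟩, b, ⟨h3, h4⟩, h5⟩
    exact ⟨a, h2, b, h4, h5, h1, h3⟩
  · rintro ⟨a, h2, b, h4, h5, h1, h3⟩
    exact ⟨a, ⟨h1, h2⟩, b, ⟨h3, h4⟩, h5⟩

theorem IsXYBigraph.mem_right {G : SimpleGraph V} {X Y : Set V} (hG : IsXYBigraph G X Y) {x y : V}
    (hx : x ∈ X) (h : G.Adj x y) : y ∈ Y :=
  hG.bipartite.mem_of_mem_adj hx h

theorem IsXYBigraph.notMem_left {G : SimpleGraph V} {X Y : Set V} (hG : IsXYBigraph G X Y) {y : V}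
    (hy : y ∈ Y) : y ∉ X :=
  fun hx => hG.bipartite.disjoint.le_bot ⟨hx, hy⟩

variable {G : SimpleGraph V} {X Y : Set V}

theorem SuperNbhdCondition.triple (hcond : SuperNbhdCondition G X Y) {a b c : V} (ha : a ∈ X)
    (hb : b ∈ X) (hc : c ∈ X) (hab : a ≠ b) (hac : a ≠ c) (hbc : b ≠ c) :
    IsTwoConnected (G.induce ({a, b, c} ∪ superNbhd G Y {a, b, c})) := by
  refine (hcond {a, b, c} ?_ ?_).2
  · rintro v (rfl | rfl | rfl) <;> assumption
  · exact (Set.ncard_eq_three.2 ⟨a, b, c, hab, hac, hbc, rfl⟩).ge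

/-- Two points `a`, `b` have a common neighbor: deleting a third point `c` from the 2-connected
graph spanned by the three leaves a connection between `a` and `b`. -/
theorem SuperNbhdCondition.exists_common [Finite V] (hG : IsXYBigraph G X Y)
    (hcond : SuperNbhdCondition G X Y) {a b c : V} (ha : a ∈ X) (hb : b ∈ X) (hc : c ∈ X)
    (hab : a ≠ b) (hac : a ≠ c) (hbc : b ≠ c) : ∃ y, G.Adj a y ∧ G.Adj b y := by
  by_contra! hno
  have key := (hcond.triple ha hb hc hab hac hbc).propagate (w := c) (a := b) (b := a)
    (p := fun v => v = b ∨ G.Adj b v) (by simp) ?_ (by simp) (by simp) hbc hac (Or.inl rfl)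
  · rcases key with h | h
    · exact hab h
    · exact hG.notMem_left (hG.mem_right hb h) ha
  · rintro u - v hv - hvc huv (rfl | hu)
    · exact Or.inr huv
    · have huY := hG.mem_right hb hu
      rcases hv with (rfl | rfl | rfl) | hv
      · exact absurd hu (hno u huv.symm)
      · exact Or.inl rfl
      · exact absurd rfl hvc
      · have huX : u ∈ X := by
          rcases hG.bipartite.mem_of_adj huv with h | h
          · exact h.1
          · exact absurd h.2 (hG.notMem_left (mem_superNbhd.1 hv).1)
        exact absurd huX (hG.notMem_left huY)

/-- A point `a` has, for any further points `b` and `c`, two neighbors that are adjacent to `b` or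
`c`: if there were only one, deleting it would isolate `a` in the graph spanned by the three. -/
theorem SuperNbhdCondition.exists_two_common [Finite V] (hG : IsXYBigraph G X Y)
    (hcond : SuperNbhdCondition G X Y) {a b c : V} (ha : a ∈ X) (hb : b ∈ X) (hc : c ∈ X)
    (hab : a ≠ b) (hac : a ≠ c) (hbc : b ≠ c) :
    ∃ y z, y ≠ z ∧ G.Adj a y ∧ G.Adj a z ∧ (G.Adj b y ∨ G.Adj c y) ∧ (G.Adj b z ∨ G.Adj c z) := by
  obtain ⟨y, hay, hby⟩ := hcond.exists_common hG ha hb hc hab hac hbc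
  by_contra! hno
  have hyY := hG.mem_right ha hay
  have hne {v : V} (hv : v ∈ X) : v ≠ y := fun e => hG.notMem_left hyY (e ▸ hv)
  refine hab.symm ((hcond.triple ha hb hc hab hac hbc).propagate (w := y) (a := a) (b := b)
    (p := fun v => v = a) ?_ ?_ (by simp) (by simp) (hne ha) (hne hb) rfl)
  · exact Or.inr (mem_superNbhd.2 ⟨hyY, a, by simp, b, by simp, hab, hay.symm, hby.symm⟩)
  · rintro u - v hv - hvy huv rfl
    exfalso
    have hvY := hG.mem_right ha huv
    rcases hv with (rfl | rfl | rfl) | hv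
    · exact hG.notMem_left hvY ha
    · exact hG.notMem_left hvY hb
    · exact hG.notMem_left hvY hc
    · obtain ⟨-, p, hp, q, hq, hpq, hvp, hvq⟩ := mem_superNbhd.1 hv
      have := hno y v hvy.symm hay huv (Or.inl hby)
      rcases hp with rfl | rfl | rfl
      · rcases hq with rfl | rfl | rfl
        · exact hpq rfl
        · exact this.1 hvq.symm
        · exact this.2 hvq.symm
      · exact this.1 hvp.symm
      · exact this.2 hvp.symm

open Classical in
theorem SuperNbhdCondition.admissible [Fintype V] (hG : IsXYBigraph G X Y)
    (hcond : SuperNbhdCondition G X Y) {n : ℕ} (hn : 3 ≤ n) {x : Fin n → V}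
    (hx : Function.Injective x) (hxX : ∀ i, x i ∈ X) :
    Admissible fun i => Finset.univ.filter fun y => G.Adj (x i) y where
  pair i j hij := by
    obtain ⟨k, hk⟩ : ∃ k, k ∉ ({i, j} : Finset (Fin n)) := by
      by_contra! h
      have := (Finset.card_le_card fun k _ => h k : (Finset.univ : Finset (Fin n)).card ≤ _).trans
        Finset.card_le_two
      rw [Finset.card_univ, Fintype.card_fin] at this
      omega
    simp only [Finset.mem_insert, Finset.mem_singleton, not_or] at hk
    obtain ⟨y, h⟩ := hcond.exists_common hG (hxX i) (hxX j) (hxX k) (hx.ne hij)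
      (hx.ne (Ne.symm hk.1)) (hx.ne (Ne.symm hk.2))
    exact ⟨y, by simpa using h⟩
  cherry i j k hij hik hjk := by
    obtain ⟨y, z, hyz, h⟩ := hcond.exists_two_common hG (hxX i) (hxX j) (hxX k) (hx.ne hij)
      (hx.ne hik) (hx.ne hjk)
    refine Finset.one_lt_card.2 ⟨y, ?_, z, ?_, hyz⟩ <;> simp [h]
  clique A hA := by
    have h := (hcond (x '' A) (by rintro _ ⟨i, -, rfl⟩; exact hxX i) (by
      rw [Set.ncard_image_of_injective _ hx, Set.ncard_coe_finset]; exact hA)).1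
    rw [Set.ncard_image_of_injective _ hx, Set.ncard_coe_finset] at h
    refine h.trans ?_
    rw [← Set.ncard_coe_finset]
    refine Set.ncard_le_ncard (fun y hy => ?_) (Set.toFinite _)
    obtain ⟨-, _, ⟨i, hi, rfl⟩, _, ⟨j, hj, rfl⟩, hij, h1, h2⟩ := mem_superNbhd.1 hy
    simp only [Finset.coe_filter, Finset.mem_filter, Finset.mem_univ, true_and, Set.mem_ofPred_eq]
    exact ⟨i, hi, j, hj, fun e => hij (e ▸ rfl), h1.symm, h2.symm⟩

/-- An alternating sequence of distinct vertices `x 0, y 0, …, y (m - 1), x m` forms a path. -/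
theorem exists_isPath {x y : ℕ → V} {m : ℕ}
    (hxy : ∀ i < m, G.Adj (x i) (y i) ∧ G.Adj (y i) (x (i + 1)))
    (hx : Set.InjOn x (Set.Iic m)) (hy : Set.InjOn y (Set.Iio m)) (hne : ∀ i j, x i ≠ y j) :
    ∃ p : G.Walk (x 0) (x m), p.IsPath ∧
      ∀ v, v ∈ p.support ↔ (∃ i ≤ m, x i = v) ∨ ∃ i < m, y i = v := by
  induction m with
  | zero => exact ⟨.nil, .nil, by simp [eq_comm]⟩
  | succ m ih =>
    obtain ⟨p, hp, hsupp⟩ := ih (fun i hi => hxy i (by omega)) (hx.mono (by intro; simp; omega))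
      (hy.mono (by intro; simp; omega))
    obtain ⟨h1, h2⟩ := hxy m (by omega)
    have hy' : y m ∉ p.support := by
      rw [hsupp]
      rintro (⟨i, -, e⟩ | ⟨i, hi, e⟩)
      · exact hne _ _ e
      · exact hi.ne (hy (Set.mem_Iio.2 (by omega)) (Set.mem_Iio.2 (by omega)) e)
    have hx' : x (m + 1) ∉ (p.concat h1).support := by
      rw [SimpleGraph.Walk.support_concat, List.mem_append, List.mem_singleton, hsupp]
      rintro ((⟨i, hi, e⟩ | ⟨i, -, e⟩) | e)
      · have := hx (Set.mem_Iic.2 (by omega)) (Set.mem_Iic.2 (by omega)) e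
        omega
      · exact hne _ _ e.symm
      · exact hne _ _ e
    refine ⟨(p.concat h1).concat h2, (hp.concat hy' h1).concat hx' h2, fun v => ?_⟩
    simp only [SimpleGraph.Walk.support_concat, List.mem_append, List.mem_singleton, hsupp,
      Nat.lt_succ_iff_lt_or_eq, Nat.le_succ_iff, or_and_right, exists_or, exists_eq_left, eq_comm (a := v),
      Nat.succ_eq_add_one]
    rw [or_assoc (c := y m = v), or_right_comm]

/-- A Berge cycle in a system of neighborhoods of points of `X` gives a cycle of the graph based on
these points. -/
theorem HasBergeCycle.hasCycleBasedOn {n : ℕ} (hn : 2 ≤ n) (hG : IsXYBigraph G X Y)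
    {N : Fin n → Finset V} (h : HasBergeCycle N) {x : Fin n → V} (hx : Function.Injective x)
    (hxX : ∀ i, x i ∈ X) (hN : ∀ i, ∀ y ∈ N i, G.Adj (x i) y) :
    HasCycleBasedOn G X (Set.range x) := by
  obtain ⟨σ, f, hf, h⟩ := h
  let r : ℕ → Fin n := fun i => ⟨i % n, Nat.mod_lt _ (by omega)⟩
  have hr : Set.InjOn r (Set.Iio n) := fun i hi j hj e => by
    have e : i % n = j % n := congrArg Fin.val e
    rwa [Nat.mod_eq_of_lt hi, Nat.mod_eq_of_lt hj] at e
  have hadj (i : ℕ) : G.Adj (x (σ (r i))) (f (r i)) ∧ G.Adj (f (r i)) (x (σ (r (i + 1)))) := by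
    obtain ⟨h1, h2⟩ := h (r i) (r (i + 1)) (by simp [r])
    exact ⟨hN _ _ h1, (hN _ _ h2).symm⟩
  have hfX (i : ℕ) : f (r i) ∉ X := hG.notMem_left (hG.mem_right (hxX _) (hadj i).1)
  obtain ⟨p, hp, hsupp⟩ := exists_isPath (G := G) (x := fun i => x (σ (r i)))
    (y := fun i => f (r i)) (m := n - 1) (fun i _ => hadj i)
    ((hx.comp σ.injective).comp_injOn (hr.mono (by intro; simp; omega)))
    (hf.comp_injOn (hr.mono (by intro; simp; omega))) (fun i j e => hfX j (e ▸ hxX _))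
  have hlast : G.Adj (x (σ (r (n - 1)))) (f (r (n - 1))) := (hadj _).1
  have hclose : G.Adj (f (r (n - 1))) (x (σ (r 0))) := by
    have := (hadj (n - 1)).2
    rwa [show r (n - 1 + 1) = r 0 from Fin.ext (by simp [r, show n - 1 + 1 = n by omega])] at this
  have hnot : f (r (n - 1)) ∉ p.support := by
    rw [hsupp]
    rintro (⟨i, -, e⟩ | ⟨i, hi, e⟩)
    · exact hfX _ (e ▸ hxX _)
    · have := hr (Set.mem_Iio.2 (by omega)) (Set.mem_Iio.2 (by omega)) (hf e)
      omega
  refine ⟨_, .cons hclose (p.concat hlast), ?_, ?_⟩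
  · rw [SimpleGraph.Walk.cons_isCycle_iff]
    refine ⟨hp.concat hnot hlast, ?_⟩
    rw [SimpleGraph.Walk.edges_concat, List.concat_eq_append, List.mem_append, List.mem_singleton]
    rintro (he | he)
    · exact hnot (p.fst_mem_support_of_mem_edges he)
    · rw [Sym2.eq_swap, Sym2.congr_left] at he
      have := hr (Set.mem_Iio.2 (by omega)) (Set.mem_Iio.2 (by omega)) (σ.injective (hx he))
      omega
  · ext v
    rw [Set.mem_inter_iff, Set.mem_ofPred_eq, SimpleGraph.Walk.support_cons, List.mem_cons,
      SimpleGraph.Walk.support_concat, List.mem_append, List.mem_singleton, hsupp, Set.mem_range]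
    constructor
    · rintro ⟨rfl | (⟨i, -, rfl⟩ | ⟨i, -, rfl⟩) | rfl, hv⟩
      · exact absurd hv (hfX _)
      · exact ⟨_, rfl⟩
      · exact absurd hv (hfX _)
      · exact absurd hv (hfX _)
    · rintro ⟨i, rfl⟩
      refine ⟨Or.inr (Or.inl (Or.inl ⟨σ.symm i, by have := (σ.symm i).2; omega, ?_⟩)), hxX i⟩
      have : r (σ.symm i) = σ.symm i := Fin.ext (Nat.mod_eq_of_lt (σ.symm i).2)
      simp [this]

end Graph

open Classical in
theorem isKCyclic_of_check {V : Type*} [Finite V] {G : SimpleGraph V} {X Y : Set V}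
    (hG : IsXYBigraph G X Y) (hcond : SuperNbhdCondition G X Y) {n : ℕ} (hn : 3 ≤ n) (hn' : n ≤ 6)
    (r : Refutation) (hr : r.check n (.initial n) = true) : IsKCyclic G X n := by
  intro X' hX' hcard
  have := Fintype.ofFinite V
  have e : Fin n ≃ X' := (Finite.equivFinOfCardEq hcard).symm
  have hx : Function.Injective fun i => (e i : V) := Subtype.val_injective.comp e.injective
  have hxX (i : Fin n) : (e i : V) ∈ X := hX' (e i).2
  have hsize : n * (n - 1) / 2 ≤ 256 := by interval_cases n <;> norm_num
  have hcycle := r.hasBergeCycle (by omega) hsize hr (hcond.admissible hG hn hx hxX)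
  have hrange : Set.range (fun i => (e i : V)) = X' :=
    (e.surjective.range_comp Subtype.val).trans Subtype.range_val
  rw [← hrange]
  exact hcycle.hasCycleBasedOn (by omega) hG hx hxX fun i y hy => (Finset.mem_filter.1 hy).2

end Bigraph

theorem theorem1p7 {V : Type*} [Finite V] (G : SimpleGraph V) (X Y : Set V)
    (hG : Bigraph.IsXYBigraph G X Y) (hcond : Bigraph.SuperNbhdCondition G X Y) :
    ∀ k : ℕ, 3 ≤ k → k ≤ 6 → Bigraph.IsKCyclic G X k := by
  intro k hk hk'
  obtain ⟨r, hr⟩ : ∃ r : Bigraph.Refutation, r.check k (.initial k) = true := by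
    interval_cases k
    exacts [⟨_, Bigraph.check_refutationThree⟩, ⟨_, Bigraph.check_refutationFour⟩,
      ⟨_, Bigraph.check_refutationFive⟩, ⟨_, Bigraph.check_refutationSix⟩]
  exact Bigraph.isKCyclic_of_check hG hcond hk hk' r hr
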